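/- Let $D\subseteq\mathbb R^2$ be open with $(0,0)\in D$ (for instance $D=\mathbb R^2$), let $q\ge 1$ be an integer, and consider $$x'=\partial_yH(x,y,t),\qquad y'=-\partial_xH(x,y,t)+F(x,y,t),\qquad (x,y)\in D,\ t>0, \tag{1}$$ where $H,F$ are $C^\infty$ on $D\times(0,\infty)$, the origin is an equilibrium ($\partial_xH=\partial_yH=F=0$ at $(0,0,t)$ for all $t>0$), and, as $t\to\infty$, $$H(x,y,t)\sim H_0(x,y)+\sum_{k\ge1}t^{-k/q}H_k(x,y),\qquad F(x,y,t)\sim\sum_{k\ge1}t^{-k/q}F_k(x,y)$$ with $H_0,H_k,F_k\in C^\infty(D)$; these are asymptotic series, uniform on compact subsets of $D$, and the one for $H$ may be differentiated once termwise in $x$ and in $y$. Assume $H_0(x,y)=\frac{x^2+y^2}2+O(r^3)$ as $r=\sqrt{x^2+y^2}\to0$, and that for every $E\in(0,E_0)$ the level set $\{(x,y)\in D: H_0(x,y)=E\}$ is a closed curve, namely the orbit of a periodic solution, of least period $2\pi/\omega(E)$ with $\omega(E)>0$, of the limiting system $x'=\partial_yH_0$, $y'=-\partial_xH_0$. Parametrize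 these curves by functions $X(\varphi,E),Y(\varphi,E)$, smooth on $\mathbb R\times(0,E_0)$ and $2\pi$-periodic in $\varphi$, with $\omega\,\partial_\varphi X=\partial_yH_0(X,Y)$, $\omega\,\partial_\varphi Y=-\partial_xH_0(X,Y)$, $H_0(X,Y)=E$. Write $\langle h\rangle=\frac1{2\pi}\int_0^{2\pi}h\,d\varphi$ and put, for $k\ge1$, $$f_k=-\omega\big(\partial_\varphi[H_k(X,Y)]-F_k(X,Y)\,\partial_\varphi X\big),\qquad g_k=\omega\big(\partial_E[H_k(X,Y)]-F_k(X,Y)\,\partial_E X\big).$$ Define $\Lambda_k(E)$ and $v_k(E,\varphi)$, $k\ge1$, recursively (with $v_j\equiv0$ for $j\le0$) by $\Lambda_k=\langle f_k\rangle-\langle Z_k\rangle$, $$v_k(E,\varphi)=H_k(X,Y)+\frac1{\omega(E)}\int_0^\varphi\big(\Lambda_k-\omega\,F_k(X,Y)\,\partial_\phi X+Z_k\big)\,d\phi,$$ $$Z_k=\sum_{j=1}^{k-1}\ \sum_{m=1}^{k-j}\frac{\Lambda_j^{(m)}(E)}{m!}\sum_{\substack{i_1,\dots,i_m\ge1\\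 i_1+\dots+i_m=k-j}}v_{i_1}\cdots v_{i_m}\;-\;\sum_{i=1}^{k-1}\big(f_{k-i}\,\partial_Ev_i+g_{k-i}\,\partial_\varphi v_i\big)+\frac{k-q}q\,v_{k-q}.$$ Let $1\le n\le q$ be such that $\Lambda_k\equiv0$ on $(0,E_0)$ for all $1\le k<n$, and let $V_c^1,\dots,V_c^s\in(0,E_0)$ satisfy $\Lambda_n(V_c^l)=0$ and $\Lambda_n'(V_c^l)<0$. Then each level curve $\gamma_l=\{(x,y)\in D:H_0(x,y)=V_c^l\}$ is a stable limit cycle of (1), in the following sense. The curve $\gamma_l$ is a closed orbit of the limiting system; and for every $\epsilon>0$ there are $\delta_*>0$ and $t_*>0$ such that for all $\tau_0\ge t_*$ and all $(x_0,y_0)\in D$ with $|H_0(x_0,y_0)-V_c^l|\le\delta_*$ the solution of (1) with $(x,y)(\tau_0)=(x_0,y_0)$ exists for all $t\ge\tau_0$ and satisfies * $|H_0(x(t),y(t))-V_c^l|<\epsilon$ and $\operatorname{dist}((x(t),y(t)),\gamma_l)<\epsilon$ for all $t\ge\tau_0$; * $H_0(x(t),y(t))\to V_c^l$ and $\operatorname{dist}((x(t),y(t)),\gamma_l)\to0$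 as $t\to\infty$, and the $\omega$-limit set of the solution (its set of limit points as $t\to\infty$) is exactly $\gamma_l$. -/

import Mathlib

open Set Filter Topology
open scoped ContDiff

noncomputable section

namespace AsympHam

/-- Partial derivative with respect to the first coordinate. -/
def dx (f : ℝ × ℝ → ℝ) (p : ℝ × ℝ) : ℝ := fderiv ℝ f p (1, 0)

/-- Partial derivative with respect to the second coordinate. -/
def dy (f : ℝ × ℝ → ℝ) (p : ℝ × ℝ) : ℝ := fderiv ℝ f p (0, 1)

/-- `G(p,t) ~ G₀(p) + ∑_{k ≥ 1} t^{-k/q} Gₖ(p)` as `t → ∞`: an asymptotic series, uniform on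
compact subsets of `D`. -/
def HasPowerExpansion (D : Set (ℝ × ℝ)) (q : ℕ) (G : ℝ × ℝ → ℝ → ℝ) (G₀ : ℝ × ℝ → ℝ)
    (Gk : ℕ → ℝ × ℝ → ℝ) : Prop :=
  ∀ K : Set (ℝ × ℝ), IsCompact K → K ⊆ D → ∀ N : ℕ, ∃ C : ℝ, ∃ T > 0, ∀ t ≥ T, ∀ p ∈ K,
    |G p t - G₀ p - ∑ k ∈ Finset.Icc 1 N, t ^ (-(k : ℝ) / q) * Gk k p|
      ≤ C * t ^ (-((N : ℝ) + 1) / q)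

/-- The asymptotically Hamiltonian system
`x' = ∂H/∂y (x,y,t)`, `y' = -∂H/∂x (x,y,t) + F(x,y,t)`, `t > 0`,
on an open phase domain `D` (for instance the whole plane) containing the origin. -/
structure System where
  D : Set (ℝ × ℝ)
  isOpen_D : IsOpen D
  zero_mem : (0 : ℝ × ℝ) ∈ D
  q : ℕ
  q_pos : 0 < q
  H : ℝ × ℝ → ℝ → ℝ
  F : ℝ × ℝ → ℝ → ℝ
  H₀ : ℝ × ℝ → ℝ
  /-- coefficients of the expansion of `H - H₀`; only indices `k ≥ 1` matter -/
  Hk : ℕ → ℝ × ℝ → ℝ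
  /-- coefficients of the expansion of `F`; only indices `k ≥ 1` matter -/
  Fk : ℕ → ℝ × ℝ → ℝ
  smooth_H : ContDiffOn ℝ ∞ (fun a : (ℝ × ℝ) × ℝ => H a.1 a.2) (D ×ˢ Ioi 0)
  smooth_F : ContDiffOn ℝ ∞ (fun a : (ℝ × ℝ) × ℝ => F a.1 a.2) (D ×ˢ Ioi 0)
  smooth_H₀ : ContDiffOn ℝ ∞ H₀ D
  smooth_Hk : ∀ k, 1 ≤ k → ContDiffOn ℝ ∞ (Hk k) D
  smooth_Fk : ∀ k, 1 ≤ k → ContDiffOn ℝ ∞ (Fk k) D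
  /-- `H₀(x,y) = (x² + y²)/2 + O(r³)` as `r → 0` -/
  center : (fun p : ℝ × ℝ => H₀ p - (p.1 ^ 2 + p.2 ^ 2) / 2)
    =O[𝓝 0] (fun p : ℝ × ℝ => Real.sqrt (p.1 ^ 2 + p.2 ^ 2) ^ 3)
  expansion_H : HasPowerExpansion D q H H₀ Hk
  /-- the expansion of `H` may be differentiated once in `x` -/
  expansion_dx : HasPowerExpansion D q (fun p t => dx (fun p' => H p' t) p) (dx H₀)
    (fun k => dx (Hk k))
  /-- the expansion of `H` may be differentiated once in `y` -/
  expansion_dy : HasPowerExpansion D q (fun p t => dy (fun p' => H p' t) p) (dy H₀)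
    (fun k => dy (Hk k))
  expansion_F : HasPowerExpansion D q F (fun _ => 0) Fk
  /-- the origin is an equilibrium of the full system -/
  equilibrium : ∀ t > 0, dx (fun p => H p t) 0 = 0 ∧ dy (fun p => H p t) 0 = 0 ∧ F 0 t = 0

namespace System

variable (S : System)

/-- The right-hand side of the full system. -/
def field (t : ℝ) (p : ℝ × ℝ) : ℝ × ℝ :=
  (dy (fun p' => S.H p' t) p, -dx (fun p' => S.H p' t) p + S.F p t)

/-- The right-hand side of the limiting Hamiltonian system. -/
def limitField (p : ℝ × ℝ) : ℝ × ℝ := (dy S.H₀ p, -dx S.H₀ p)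

/-- `z` is a solution of the full system on `[τ, ∞)`, with values in the phase domain. -/
def IsSolution (τ : ℝ) (z : ℝ → ℝ × ℝ) : Prop :=
  ∀ t ∈ Ici τ, z t ∈ S.D ∧ HasDerivWithinAt z (S.field t (z t)) (Ici τ) t

/-- The level curve `{H₀ = c}` in the phase domain. -/
def levelCurve (c : ℝ) : Set (ℝ × ℝ) := {p | p ∈ S.D ∧ S.H₀ p = c}

/-- `γ` is the orbit of a non-constant periodic solution of the limiting system (and so a simple
closed curve). -/
def IsClosedOrbit (γ : Set (ℝ × ℝ)) : Prop :=
  ∃ T > 0, ∃ u : ℝ → ℝ × ℝ, (∀ t, HasDerivAt u (S.limitField (u t)) t) ∧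
    Function.Periodic u T ∧ InjOn u (Ico 0 T) ∧ range u = γ

/-- The level curve `γ = {H₀ = c}` is a stable limit cycle of the full (non-autonomous) system:
it is a cycle of the limiting system, and solutions of the full system which start near `γ`, at any
sufficiently late time, exist for all later times, stay near `γ`, approach it, and have it as their
`ω`-limit set. -/
def IsStableLimitCycle (c : ℝ) : Prop :=
  S.IsClosedOrbit (S.levelCurve c) ∧
  ∀ ε > 0, ∃ δ > 0, ∃ tstar > 0, ∀ τ ≥ tstar, ∀ z₀ ∈ S.D, |S.H₀ z₀ - c| ≤ δ →
    (∃ z, S.IsSolution τ z ∧ z τ = z₀) ∧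
    ∀ z, S.IsSolution τ z → z τ = z₀ →
      (∀ t ≥ τ, |S.H₀ (z t) - c| < ε ∧ Metric.infDist (z t) (S.levelCurve c) < ε) ∧
      Tendsto (fun t => S.H₀ (z t)) atTop (𝓝 c) ∧
      Tendsto (fun t => Metric.infDist (z t) (S.levelCurve c)) atTop (𝓝 0) ∧
      {p | MapClusterPt p atTop z} = S.levelCurve c

end System

/-- Action-angle variables of the limiting system on `0 < E < E₀`: each level curve `{H₀ = E}` is a
closed curve, run through by a periodic solution of period `2π / freq E`; `X` and `Y` are its
coordinates in terms of the energy `E` (first argument) and the angle `φ` (second argument). The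
initial point `φ = 0` on each curve is free, as long as it depends smoothly on `E`. -/
structure ActionAngle (S : System) (E₀ : ℝ) where
  X : ℝ → ℝ → ℝ
  Y : ℝ → ℝ → ℝ
  freq : ℝ → ℝ
  smooth_X : ContDiffOn ℝ ∞ (fun a : ℝ × ℝ => X a.1 a.2) (Ioo 0 E₀ ×ˢ univ)
  smooth_Y : ContDiffOn ℝ ∞ (fun a : ℝ × ℝ => Y a.1 a.2) (Ioo 0 E₀ ×ˢ univ)
  freq_pos : ∀ E ∈ Ioo 0 E₀, 0 < freq E
  periodic : ∀ E ∈ Ioo 0 E₀, Function.Periodic (fun φ => (X E φ, Y E φ)) (2 * Real.pi)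
  injOn : ∀ E ∈ Ioo 0 E₀, InjOn (fun φ => (X E φ, Y E φ)) (Ico 0 (2 * Real.pi))
  range_eq : ∀ E ∈ Ioo 0 E₀, range (fun φ => (X E φ, Y E φ)) = S.levelCurve E
  eq_X : ∀ E ∈ Ioo 0 E₀, ∀ φ, freq E * deriv (X E) φ = dy S.H₀ (X E φ, Y E φ)
  eq_Y : ∀ E ∈ Ioo 0 E₀, ∀ φ, freq E * deriv (Y E) φ = -dx S.H₀ (X E φ, Y E φ)

/-- Average over the angle. -/
def avg (h : ℝ → ℝ) : ℝ := (1 / (2 * Real.pi)) * ∫ φ in (0)..(2 * Real.pi), h φ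

namespace ActionAngle

variable {S : System} {E₀ : ℝ} (A : ActionAngle S E₀)

/-- Coefficient of `t^{-k/q}` in `dE/dt`. -/
def f (k : ℕ) (E φ : ℝ) : ℝ :=
  -A.freq E * (deriv (fun ψ => S.Hk k (A.X E ψ, A.Y E ψ)) φ
    - S.Fk k (A.X E φ, A.Y E φ) * deriv (fun ψ => A.X E ψ) φ)

/-- Coefficient of `t^{-k/q}` in `dφ/dt`. -/
def g (k : ℕ) (E φ : ℝ) : ℝ :=
  A.freq E * (deriv (fun e => S.Hk k (A.X e φ, A.Y e φ)) E
    - S.Fk k (A.X E φ, A.Y E φ) * deriv (fun e => A.X e φ) E)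

/-- The function `Z_k` formed from given sequences `L` (in the role of `Λ`) and `v`, with
`v 0 = 0`. Its first sum is the coefficient of `s^k`, without the term `L k E`, in the Taylor
expansion of `∑ j, s^j * L j (E + ∑ i, s^i * v i E φ)` in powers of `s`; only the `L i`, `v i` with
`i < k` occur. -/
def Zfun (L : ℕ → ℝ → ℝ) (v : ℕ → ℝ → ℝ → ℝ) (k : ℕ) (E φ : ℝ) : ℝ :=
  (∑ j ∈ Finset.Ico 1 k, ∑ m ∈ Finset.Icc 1 (k - j),
      iteratedDeriv m (L j) E / (m.factorial : ℝ) *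
        ∑ a ∈ Finset.piAntidiag (Finset.univ : Finset (Fin m)) (k - j), ∏ l, v (a l) E φ)
    - (∑ i ∈ Finset.Ico 1 k,
        (A.f (k - i) E φ * deriv (fun e => v i e φ) E + A.g (k - i) E φ * deriv (v i E) φ))
    + (if S.q < k then ((k : ℝ) - S.q) / S.q * v (k - S.q) E φ else 0)

/-- One step of the recursion: `Λ_k = ⟨f_k⟩ - ⟨Z_k⟩`, and `v_k` by integration in `φ`. -/
def step (L : ℕ → ℝ → ℝ) (v : ℕ → ℝ → ℝ → ℝ) (k : ℕ) : (ℝ → ℝ) × (ℝ → ℝ → ℝ) :=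
  if k = 0 then 0 else
    (fun E => avg (A.f k E) - avg (A.Zfun L v k E),
     fun E φ => S.Hk k (A.X E φ, A.Y E φ) + 1 / A.freq E * ∫ ψ in (0)..φ,
      ((avg (A.f k E) - avg (A.Zfun L v k E))
        - A.freq E * S.Fk k (A.X E ψ, A.Y E ψ) * deriv (fun ψ' => A.X E ψ') ψ
        + A.Zfun L v k E ψ))

/-- The pair `(Λ_k, v_k)`, by recursion on `k`. -/
def coeff (k : ℕ) : (ℝ → ℝ) × (ℝ → ℝ → ℝ) :=
  A.step (fun i => if _h : i < k then (coeff i).1 else 0)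
    (fun i => if _h : i < k then (coeff i).2 else 0) k
termination_by k

/-- The functions `Λ_k(E)`. -/
def Lam (k : ℕ) : ℝ → ℝ := (A.coeff k).1

/-- The functions `v_k(E, φ)`, with `v_0 = 0`. -/
def v (k : ℕ) : ℝ → ℝ → ℝ := (A.coeff k).2

/-- The functions `Z_k(E, φ)`. -/
def Z (k : ℕ) : ℝ → ℝ → ℝ := A.Zfun A.Lam A.v k

theorem Zfun_congr {L L' : ℕ → ℝ → ℝ} {v v' : ℕ → ℝ → ℝ → ℝ} {k : ℕ}
    (hL : ∀ i < k, L i = L' i) (hv : ∀ i < k, v i = v' i) : A.Zfun L v k = A.Zfun L' v' k := by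
  funext E φ
  unfold Zfun
  congr 1
  · congr 1
    · refine Finset.sum_congr rfl fun j hj => Finset.sum_congr rfl fun m _ => ?_
      rw [Finset.mem_Ico] at hj
      rw [hL j hj.2]
      congr 1
      refine Finset.sum_congr rfl fun a ha => Finset.prod_congr rfl fun l _ => ?_
      rw [Finset.mem_piAntidiag] at ha
      have h1 : a l ≤ k - j := by
        rw [← ha.1]
        exact Finset.single_le_sum (fun _ _ => Nat.zero_le _) (Finset.mem_univ l)
      rw [hv (a l) (by omega)]
    · refine Finset.sum_congr rfl fun i hi => ?_
      rw [Finset.mem_Ico] at hi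
      rw [hv i hi.2]
  · split_ifs with h
    · rw [hv _ (by have := S.q_pos; omega)]
    · rfl

theorem coeff_eq (k : ℕ) : A.coeff k = A.step A.Lam A.v k := by
  rw [coeff]
  have := A.Zfun_congr (k := k) (L := fun i => if _h : i < k then (A.coeff i).1 else 0)
    (v := fun i => if _h : i < k then (A.coeff i).2 else 0) (L' := A.Lam) (v' := A.v)
    (fun i hi => by simp [hi, Lam]) (fun i hi => by simp [hi, ActionAngle.v])
  unfold step
  rw [this]

theorem v_zero : A.v 0 = 0 := by
  simp [ActionAngle.v, coeff_eq, step]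

/-- `Λ_k = ⟨f_k⟩ - ⟨Z_k⟩`. -/
theorem Lam_eq {k : ℕ} (hk : 1 ≤ k) (E : ℝ) : A.Lam k E = avg (A.f k E) - avg (A.Z k E) := by
  have h : k ≠ 0 := by omega
  simp [Lam, coeff_eq, step, h, Z]

/-- `v_k = H_k + (1/freq) ∫₀^φ (Λ_k - freq F_k ∂X/∂φ + Z_k)`. -/
theorem v_eq {k : ℕ} (hk : 1 ≤ k) (E φ : ℝ) :
    A.v k E φ = S.Hk k (A.X E φ, A.Y E φ) + 1 / A.freq E * ∫ ψ in (0)..φ,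
      (A.Lam k E - A.freq E * S.Fk k (A.X E ψ, A.Y E ψ) * deriv (fun ψ' => A.X E ψ') ψ
        + A.Z k E ψ) := by
  have h : k ≠ 0 := by omega
  rw [A.Lam_eq hk]
  simp [ActionAngle.v, coeff_eq, step, h, Z]

end ActionAngle

end AsympHam

end

/-! In energy-angle coordinates the system reads E' = ∑ t^{-k/q} f_k, φ' = ω + ∑ t^{-k/q} g_k up to
the order considered, k ≥ 1. The v_k solve the homological equations ω ∂_φ v_k = Λ_k - f_k + Z_k,
where Λ_k is the mean value that makes periodic solutions possible. As Λ_k = 0 for k < n, the Taylor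
terms of Z_k vanish for k ≤ n; as n ≤ q, differentiating t^{-k/q} contributes only beyond order n.
Hence V = H₀ + ∑_{k ≤ n} t^{-k/q} v_k satisfies V' = t^{-n/q} Λ_n(H₀) + O(t^{-(n+1)/q})
(`exists_averaging`, `exists_lyapunov`). The periodic v_k descend to the annulus of closed orbits,
so no angle has to be followed along a solution.

Near c = V_c^l the function Λ_n is close to -2a(E - c), so y = V - c obeys (y²)' ≤ t^{-n/q} (-a y² +
C t^{-1/q}) (`exists_dissipation`). The integral of t^{-n/q} diverges because n ≤ q, which forces y
→ 0; since V - H₀ = O(t^{-1/q}), the energy stays near c and tends to c (`exists_energy_estimates`).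
A first-exit argument keeps solutions in a compact band (`exists_confinement`), where the cut-off
field that provides global existence agrees with the true one.

The ω-limit set is nonempty by compactness, lies on the level curve because H₀ → c, and is forward
invariant under the limiting flow by Gronwall (`mapClusterPt_flow`). The curve is a single periodic
orbit, so the ω-limit set is all of it. -/

noncomputable section

namespace AsympHam

/-! ### Smooth dependence of integrals on parameters. -/

section ParametricIntegral

variable {E G : Type} [NormedAddCommGroup E] [NormedSpace ℝ E] [ProperSpace E]
  [NormedAddCommGroup G] [NormedSpace ℝ G]

/-- Properness makes a closed ball around `x` compact; on its product with the interval the partial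
derivative is bounded, and this constant is the dominating function. -/
theorem hasFDerivAt_integral_of_contDiffOn {F : E × ℝ → G} {U : Set E} (hU : IsOpen U)
    (hF : ContDiffOn ℝ 1 F (U ×ˢ univ)) {x : E} (hx : x ∈ U) (a b : ℝ) :
    HasFDerivAt (fun x => ∫ s in a..b, F (x, s))
      (∫ s in a..b, (fderiv ℝ F (x, s)).comp (ContinuousLinearMap.inl ℝ E ℝ)) x := by
  have hO : IsOpen (U ×ˢ (univ : Set ℝ)) := hU.prod isOpen_univ
  have hF' : ContinuousOn
      (fun p : E × ℝ => (fderiv ℝ F p).comp (ContinuousLinearMap.inl ℝ E ℝ)) (U ×ˢ univ) :=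
    (hF.continuousOn_fderiv_of_isOpen hO le_rfl).clm_comp continuousOn_const
  have hslice : ∀ y ∈ U, ∀ s : ℝ, (y, s) ∈ U ×ˢ (univ : Set ℝ) := fun y hy s => ⟨hy, trivial⟩
  have hcont : ∀ y ∈ U, Continuous fun s : ℝ => F (y, s) := fun y hy =>
    hF.continuousOn.comp_continuous (by fun_prop) (hslice y hy)
  have hcont' : ∀ y ∈ U, Continuous fun s : ℝ =>
      (fderiv ℝ F (y, s)).comp (ContinuousLinearMap.inl ℝ E ℝ) := fun y hy =>
    hF'.comp_continuous (f := fun s : ℝ => (y, s)) (by fun_prop) (hslice y hy)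
  obtain ⟨r, hr, hrU⟩ := Metric.nhds_basis_closedBall.mem_iff.1 (hU.mem_nhds hx)
  obtain ⟨C, hC⟩ := ((isCompact_closedBall x r).prod (isCompact_uIcc (a := a) (b := b))
    ).exists_bound_of_continuousOn (hF'.mono (prod_mono hrU (subset_univ _)))
  refine intervalIntegral.hasFDerivAt_integral_of_dominated_of_fderiv_le
    (bound := fun _ => C) (F' := fun y s =>
      (fderiv ℝ F (y, s)).comp (ContinuousLinearMap.inl ℝ E ℝ)) (Metric.closedBall_mem_nhds x hr) ?_
    ((hcont x hx).intervalIntegrable _ _) (hcont' x hx).aestronglyMeasurable ?_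
    intervalIntegrable_const ?_
  · filter_upwards [hU.mem_nhds hx] with y hy using (hcont y hy).aestronglyMeasurable
  · exact Eventually.of_forall fun s hs y hy => hC (y, s) ⟨hy, uIoc_subset_uIcc hs⟩
  · refine Eventually.of_forall fun s _ y hy => ?_
    have h1 : HasFDerivAt F (fderiv ℝ F (y, s)) (y, s) :=
      ((hF.contDiffAt (hO.mem_nhds (hslice y (hrU hy) s))).differentiableAt one_ne_zero).hasFDerivAt
    exact h1.comp y (hasFDerivAt_prodMk_left y s)

/-- Induction on the order: the derivative is an integral of the same kind with values in a space of
operators, hence the generalization over `G`. -/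
theorem contDiffOn_integral {F : E × ℝ → G} {U : Set E} (hU : IsOpen U)
    (hF : ContDiffOn ℝ ∞ F (U ×ˢ univ)) (a b : ℝ) :
    ContDiffOn ℝ ∞ (fun x => ∫ s in a..b, F (x, s)) U := by
  refine contDiffOn_infty.2 fun n => ?_
  induction n generalizing G with
  | zero =>
    refine contDiffOn_zero.2 fun x hx => ?_
    exact (hasFDerivAt_integral_of_contDiffOn hU (hF.of_le (by simp)) hx a b
      ).continuousAt.continuousWithinAt
  | succ n ih =>
    have hO : IsOpen (U ×ˢ (univ : Set ℝ)) := hU.prod isOpen_univ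
    have hd := fun x hx => hasFDerivAt_integral_of_contDiffOn (x := x) hU (hF.of_le (by simp)) hx a b
    push_cast
    refine (contDiffOn_succ_iff_fderiv_of_isOpen hU).2
      ⟨fun x hx => (hd x hx).differentiableAt.differentiableWithinAt, by simp, ?_⟩
    refine ContDiffOn.congr (ih (F := fun p => (fderiv ℝ F p).comp
      (ContinuousLinearMap.inl ℝ E ℝ)) ?_) fun x hx => (hd x hx).fderiv
    exact (hF.fderiv_of_isOpen hO (by simp)).clm_comp contDiffOn_const

end ParametricIntegral

section Partial

variable {h : ℝ → ℝ → ℝ} {I : Set ℝ}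

theorem hasDerivAt_fst_of_contDiffOn (hI : IsOpen I)
    (hh : ContDiffOn ℝ ∞ (fun a : ℝ × ℝ => h a.1 a.2) (I ×ˢ univ)) {E : ℝ} (hE : E ∈ I) (φ : ℝ) :
    HasDerivAt (fun e => h e φ) (fderiv ℝ (fun a : ℝ × ℝ => h a.1 a.2) (E, φ) (1, 0)) E := by
  have h1 := ((hh.contDiffAt ((hI.prod isOpen_univ).mem_nhds
    (show (E, φ) ∈ I ×ˢ univ from ⟨hE, trivial⟩))).differentiableAt (by simp)).hasFDerivAt
  have h2 : HasDerivAt (fun e : ℝ => (e, φ)) ((1, 0) : ℝ × ℝ) E :=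
    (hasDerivAt_id E).prodMk (hasDerivAt_const E φ)
  exact h1.comp_hasDerivAt E h2

theorem hasDerivAt_snd_of_contDiffOn (hI : IsOpen I)
    (hh : ContDiffOn ℝ ∞ (fun a : ℝ × ℝ => h a.1 a.2) (I ×ˢ univ)) {E : ℝ} (hE : E ∈ I) (φ : ℝ) :
    HasDerivAt (h E) (fderiv ℝ (fun a : ℝ × ℝ => h a.1 a.2) (E, φ) (0, 1)) φ := by
  have h1 := ((hh.contDiffAt ((hI.prod isOpen_univ).mem_nhds
    (show (E, φ) ∈ I ×ˢ univ from ⟨hE, trivial⟩))).differentiableAt (by simp)).hasFDerivAt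
  have h2 : HasDerivAt (fun ψ : ℝ => (E, ψ)) ((0, 1) : ℝ × ℝ) φ :=
    (hasDerivAt_const φ E).prodMk (hasDerivAt_id φ)
  exact h1.comp_hasDerivAt φ h2

theorem contDiffOn_deriv_fst (hI : IsOpen I)
    (hh : ContDiffOn ℝ ∞ (fun a : ℝ × ℝ => h a.1 a.2) (I ×ˢ univ)) :
    ContDiffOn ℝ ∞ (fun a : ℝ × ℝ => deriv (fun e => h e a.2) a.1) (I ×ˢ univ) :=
  ((hh.fderiv_of_isOpen (hI.prod isOpen_univ) (by simp)).clm_apply contDiffOn_const).congr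
    fun a ha => (hasDerivAt_fst_of_contDiffOn hI hh ha.1 a.2).deriv

theorem contDiffOn_deriv_snd (hI : IsOpen I)
    (hh : ContDiffOn ℝ ∞ (fun a : ℝ × ℝ => h a.1 a.2) (I ×ˢ univ)) :
    ContDiffOn ℝ ∞ (fun a : ℝ × ℝ => deriv (h a.1) a.2) (I ×ˢ univ) :=
  ((hh.fderiv_of_isOpen (hI.prod isOpen_univ) (by simp)).clm_apply contDiffOn_const).congr
    fun a ha => (hasDerivAt_snd_of_contDiffOn hI hh ha.1 a.2).deriv

theorem continuous_snd_of_contDiffOn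
    (hh : ContDiffOn ℝ ∞ (fun a : ℝ × ℝ => h a.1 a.2) (I ×ˢ univ)) {E : ℝ} (hE : E ∈ I) :
    Continuous (h E) :=
  hh.continuousOn.comp_continuous (f := fun φ : ℝ => (E, φ)) (by fun_prop)
    fun φ => ⟨hE, trivial⟩

/-- The primitive in the second variable of a smooth function is smooth in both variables. -/
theorem contDiffOn_primitive (hI : IsOpen I)
    (hh : ContDiffOn ℝ ∞ (fun a : ℝ × ℝ => h a.1 a.2) (I ×ˢ univ)) :
    ContDiffOn ℝ ∞ (fun a : ℝ × ℝ => ∫ ψ in (0)..a.2, h a.1 ψ) (I ×ˢ univ) := by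
  -- Substituting ψ = s·φ fixes the limits at 0 and 1, at the price of a factor φ.
  have h1 : ContDiffOn ℝ ∞ (fun b : (ℝ × ℝ) × ℝ => h b.1.1 (b.2 * b.1.2))
      ((I ×ˢ univ) ×ˢ univ) :=
    hh.comp (f := fun b : (ℝ × ℝ) × ℝ => (b.1.1, b.2 * b.1.2)) (by fun_prop)
      fun b hb => ⟨hb.1.1, trivial⟩
  have h2 := contDiffOn_snd.mul (contDiffOn_integral (hI.prod isOpen_univ) h1 0 1)
  refine h2.congr fun a _ => ?_
  simp

theorem contDiffOn_avg (hI : IsOpen I)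
    (hh : ContDiffOn ℝ ∞ (fun a : ℝ × ℝ => h a.1 a.2) (I ×ˢ univ)) :
    ContDiffOn ℝ ∞ (fun E => avg (h E)) I :=
  contDiffOn_const.mul (contDiffOn_integral hI hh 0 (2 * Real.pi))

end Partial

theorem exists_mem_Ico_of_periodic {α β : Type*} {c : ℝ → α} {h : ℝ → β} {T : ℝ} (hT : 0 < T)
    (hc : Function.Periodic c T) (hh : Function.Periodic h T) (φ : ℝ) :
    ∃ θ ∈ Ico 0 T, c θ = c φ ∧ h θ = h φ := by
  refine ⟨toIcoMod hT 0 φ, by simpa using toIcoMod_mem_Ico hT 0 φ, ?_, ?_⟩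
  · rw [toIcoMod]; exact hc.sub_zsmul_eq _
  · rw [toIcoMod]; exact hh.sub_zsmul_eq _

/-- A periodic function factors through a periodic curve which is injective on one period. -/
theorem eq_of_periodic_of_injOn {α β : Type*} {c : ℝ → α} {h : ℝ → β} {T : ℝ} (hT : 0 < T)
    (hc : Function.Periodic c T) (hinj : InjOn c (Ico 0 T)) (hh : Function.Periodic h T)
    {φ ψ : ℝ} (heq : c φ = c ψ) : h φ = h ψ := by
  obtain ⟨φ', hφ', h1, h2⟩ := exists_mem_Ico_of_periodic hT hc hh φ
  obtain ⟨ψ', hψ', h3, h4⟩ := exists_mem_Ico_of_periodic hT hc hh ψ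
  rw [← h2, ← h4, hinj hφ' hψ' (by rw [h1, h3, heq])]

/-! ### Field coefficients, the energy-angle chart, and descent to the annulus. -/

namespace System

variable (S : System)

/-- The coefficient of `t^{-k/q}` in the expansion of the vector field. -/
def fieldCoeff (k : ℕ) (p : ℝ × ℝ) : ℝ × ℝ :=
  if k = 0 then S.limitField p else (dy (S.Hk k) p, -dx (S.Hk k) p + S.Fk k p)

/-- The part of the phase domain with energies between `0` and `E₀`. -/
def annulus (E₀ : ℝ) : Set (ℝ × ℝ) := {p | p ∈ S.D ∧ S.H₀ p ∈ Ioo 0 E₀}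

theorem isOpen_annulus (E₀ : ℝ) : IsOpen (S.annulus E₀) :=
  S.smooth_H₀.continuousOn.isOpen_inter_preimage S.isOpen_D isOpen_Ioo

end System

theorem contDiffOn_dx {D : Set (ℝ × ℝ)} (hD : IsOpen D) {f : ℝ × ℝ → ℝ} (hf : ContDiffOn ℝ ∞ f D) :
    ContDiffOn ℝ ∞ (dx f) D :=
  (hf.fderiv_of_isOpen hD (by simp)).clm_apply contDiffOn_const

theorem contDiffOn_dy {D : Set (ℝ × ℝ)} (hD : IsOpen D) {f : ℝ × ℝ → ℝ} (hf : ContDiffOn ℝ ∞ f D) :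
    ContDiffOn ℝ ∞ (dy f) D :=
  (hf.fderiv_of_isOpen hD (by simp)).clm_apply contDiffOn_const

theorem fderiv_apply_eq (f : ℝ × ℝ → ℝ) (p v : ℝ × ℝ) :
    fderiv ℝ f p v = dx f p * v.1 + dy f p * v.2 := by
  have : v = v.1 • ((1, 0) : ℝ × ℝ) + v.2 • ((0, 1) : ℝ × ℝ) := by simp
  conv_lhs => rw [this, map_add, map_smul, map_smul]
  simp [dx, dy, mul_comm]

theorem System.contDiffOn_fieldCoeff (S : System) (k : ℕ) :
    ContDiffOn ℝ ∞ (S.fieldCoeff k) S.D := by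
  unfold System.fieldCoeff
  split_ifs with hk
  · exact (contDiffOn_dy S.isOpen_D S.smooth_H₀).prodMk (contDiffOn_dx S.isOpen_D S.smooth_H₀).neg
  · have hk' : 1 ≤ k := Nat.one_le_iff_ne_zero.2 hk
    exact (contDiffOn_dy S.isOpen_D (S.smooth_Hk k hk')).prodMk
      ((contDiffOn_dx S.isOpen_D (S.smooth_Hk k hk')).neg.add (S.smooth_Fk k hk'))

namespace ActionAngle

variable {S : System} {E₀ : ℝ} (A : ActionAngle S E₀)

/-- The map from energy and angle to the phase plane. -/
def chart (a : ℝ × ℝ) : ℝ × ℝ := (A.X a.1 a.2, A.Y a.1 a.2)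

theorem contDiffOn_chart : ContDiffOn ℝ ∞ A.chart (Ioo 0 E₀ ×ˢ univ) :=
  A.smooth_X.prodMk A.smooth_Y

theorem contDiffAt_chart {a : ℝ × ℝ} (ha : a.1 ∈ Ioo 0 E₀) : ContDiffAt ℝ ∞ A.chart a :=
  A.contDiffOn_chart.contDiffAt ((isOpen_Ioo.prod isOpen_univ).mem_nhds ⟨ha, trivial⟩)

theorem chart_mem_levelCurve {E : ℝ} (hE : E ∈ Ioo 0 E₀) (φ : ℝ) :
    A.chart (E, φ) ∈ S.levelCurve E := by
  rw [← A.range_eq E hE]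
  exact ⟨φ, rfl⟩

theorem exists_chart_eq {p : ℝ × ℝ} (hp : p ∈ S.annulus E₀) : ∃ φ, A.chart (S.H₀ p, φ) = p := by
  have : p ∈ S.levelCurve (S.H₀ p) := ⟨hp.1, rfl⟩
  rwa [← A.range_eq _ hp.2] at this

theorem chart_mem_annulus {E : ℝ} (hE : E ∈ Ioo 0 E₀) (φ : ℝ) :
    A.chart (E, φ) ∈ S.annulus E₀ :=
  ⟨(A.chart_mem_levelCurve hE φ).1, by rwa [(A.chart_mem_levelCurve hE φ).2]⟩

theorem hasDerivAt_chart_fst {E : ℝ} (hE : E ∈ Ioo 0 E₀) (φ : ℝ) :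
    HasDerivAt (fun e => A.chart (e, φ))
      (deriv (fun e => A.X e φ) E, deriv (fun e => A.Y e φ) E) E :=
  (hasDerivAt_fst_of_contDiffOn isOpen_Ioo A.smooth_X hE φ).differentiableAt.hasDerivAt.prodMk
    (hasDerivAt_fst_of_contDiffOn isOpen_Ioo A.smooth_Y hE φ).differentiableAt.hasDerivAt

theorem hasDerivAt_chart_snd {E : ℝ} (hE : E ∈ Ioo 0 E₀) (φ : ℝ) :
    HasDerivAt (fun ψ => A.chart (E, ψ)) (deriv (A.X E) φ, deriv (A.Y E) φ) φ :=
  (hasDerivAt_snd_of_contDiffOn isOpen_Ioo A.smooth_X hE φ).differentiableAt.hasDerivAt.prodMk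
    (hasDerivAt_snd_of_contDiffOn isOpen_Ioo A.smooth_Y hE φ).differentiableAt.hasDerivAt

/-- The chain rule for functions on the phase plane in terms of energy and angle. -/
theorem deriv_comp_chart {W : ℝ × ℝ → ℝ} {h : ℝ → ℝ → ℝ} {E φ : ℝ} (hE : E ∈ Ioo 0 E₀)
    (hW : DifferentiableAt ℝ W (A.chart (E, φ)))
    (hh : ∀ e ∈ Ioo 0 E₀, ∀ ψ, W (A.chart (e, ψ)) = h e ψ) :
    deriv (fun e => h e φ) E = dx W (A.chart (E, φ)) * deriv (fun e => A.X e φ) E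
        + dy W (A.chart (E, φ)) * deriv (fun e => A.Y e φ) E ∧
      deriv (h E) φ = dx W (A.chart (E, φ)) * deriv (A.X E) φ
        + dy W (A.chart (E, φ)) * deriv (A.Y E) φ := by
  constructor
  · have h1 := hW.hasFDerivAt.comp_hasDerivAt E (A.hasDerivAt_chart_fst hE φ)
    rw [fderiv_apply_eq] at h1
    refine (h1.congr_of_eventuallyEq ?_).deriv
    filter_upwards [isOpen_Ioo.mem_nhds hE] with e he using (hh e he φ).symm
  · have h1 := hW.hasFDerivAt.comp_hasDerivAt φ (A.hasDerivAt_chart_snd hE φ)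
    rw [fderiv_apply_eq] at h1
    refine (h1.congr_of_eventuallyEq ?_).deriv
    exact Eventually.of_forall fun ψ => (hh E hE ψ).symm

/-- Differentiate H₀(X, Y) = E in E and insert Hamilton's equations. The Jacobian is thus -1/ω, so
the chart is a local diffeomorphism. -/
theorem freq_mul_det {E : ℝ} (hE : E ∈ Ioo 0 E₀) (φ : ℝ) :
    A.freq E * (deriv (fun e => A.X e φ) E * deriv (A.Y E) φ
      - deriv (A.X E) φ * deriv (fun e => A.Y e φ) E) = -1 := by
  have hp := A.chart_mem_annulus hE φ
  have h1 := (A.deriv_comp_chart (W := S.H₀) (h := fun e _ => e) (φ := φ) hE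
    ((S.smooth_H₀.contDiffAt (S.isOpen_D.mem_nhds hp.1)).differentiableAt (by simp))
    fun e he ψ => (A.chart_mem_levelCurve he ψ).2).1
  have h2 := A.eq_X E hE φ
  have h3 := A.eq_Y E hE φ
  simp only [deriv_id''] at h1
  simp only [chart] at h1
  linear_combination (deriv (fun e => A.X e φ) E) * h3 - (deriv (fun e => A.Y e φ) E) * h2 + h1

/-- Smoothness of the frequency is not part of `ActionAngle`; it follows because ω is minus the
reciprocal of the Jacobian at φ = 0. -/
theorem contDiffOn_freq : ContDiffOn ℝ ∞ A.freq (Ioo 0 E₀) := by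
  have hs : ContDiffOn ℝ ∞ (fun E : ℝ => ((E, 0) : ℝ × ℝ)) (Ioo 0 E₀) := by fun_prop
  have hm : MapsTo (fun E : ℝ => ((E, 0) : ℝ × ℝ)) (Ioo 0 E₀) (Ioo 0 E₀ ×ˢ univ) :=
    fun E hE => ⟨hE, trivial⟩
  have h1 := (((contDiffOn_deriv_fst isOpen_Ioo A.smooth_X).mul
    (contDiffOn_deriv_snd isOpen_Ioo A.smooth_Y)).sub
    ((contDiffOn_deriv_snd isOpen_Ioo A.smooth_X).mul
    (contDiffOn_deriv_fst isOpen_Ioo A.smooth_Y))).comp hs hm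
  have h2 := fun E (hE : E ∈ Ioo 0 E₀) => A.freq_mul_det hE 0
  refine (h1.inv fun E hE h0 => ?_).neg.congr fun E hE => ?_
  · have := h2 E hE
    simp only [Function.comp_def] at h0
    rw [h0] at this
    norm_num at this
  · have h3 := h2 E hE
    simp only [Function.comp_def]
    rw [Pi.inv_apply, ← inv_neg]
    exact eq_inv_of_mul_eq_one_left (by linear_combination -h3)

theorem fderiv_chart_injective {a : ℝ × ℝ} (ha : a.1 ∈ Ioo 0 E₀) :
    Function.Injective (fderiv ℝ A.chart a) := by
  obtain ⟨E, φ⟩ := a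
  replace ha : E ∈ Ioo 0 E₀ := ha
  have hd := ((A.contDiffAt_chart (a := (E, φ)) ha).differentiableAt (by simp)).hasFDerivAt
  have h1 : fderiv ℝ A.chart (E, φ) (1, 0) = _ := (hd.comp_hasDerivAt E
    (f := fun e => (e, φ)) ((hasDerivAt_id E).prodMk (hasDerivAt_const E φ))).unique
    (A.hasDerivAt_chart_fst ha φ)
  have h2 : fderiv ℝ A.chart (E, φ) (0, 1) = _ := (hd.comp_hasDerivAt φ
    (f := fun ψ => (E, ψ)) ((hasDerivAt_const φ E).prodMk (hasDerivAt_id φ))).unique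
    (A.hasDerivAt_chart_snd ha φ)
  rw [injective_iff_map_eq_zero]
  rintro ⟨x, y⟩ hv
  have hxy : ((x, y) : ℝ × ℝ) = x • ((1, 0) : ℝ × ℝ) + y • ((0, 1) : ℝ × ℝ) := by simp
  rw [hxy, map_add, map_smul, map_smul, h1, h2, Prod.ext_iff] at hv
  simp only [Prod.smul_mk, Prod.mk_add_mk, Prod.fst_zero, Prod.snd_zero, smul_eq_mul] at hv
  obtain ⟨hv1, hv2⟩ := hv
  have hdet := A.freq_mul_det ha φ
  ext
  · simp only [Prod.fst_zero]
    -- Cramer's rule, with determinant -1/ω.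
    linear_combination x * hdet - A.freq E * deriv (A.Y E) φ * hv1
      + A.freq E * deriv (A.X E) φ * hv2
  · simp only [Prod.snd_zero]
    linear_combination y * hdet + A.freq E * deriv (fun e => A.Y e φ) E * hv1
      - A.freq E * deriv (fun e => A.X e φ) E * hv2

/-- A smooth function of energy and angle, `2π`-periodic in the angle, is a smooth function on the
annulus. -/
theorem exists_descent {h : ℝ → ℝ → ℝ}
    (hh : ContDiffOn ℝ ∞ (fun a : ℝ × ℝ => h a.1 a.2) (Ioo 0 E₀ ×ˢ univ))
    (hper : ∀ E ∈ Ioo 0 E₀, Function.Periodic (h E) (2 * Real.pi)) :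
    ∃ W : ℝ × ℝ → ℝ, ContDiffOn ℝ ∞ W (S.annulus E₀) ∧
      ∀ E ∈ Ioo 0 E₀, ∀ φ, W (A.chart (E, φ)) = h E φ := by
  -- The angle θ(p) is chosen without any continuity; `hW` shows that h(E, θ) does not depend on the
  -- choice.
  have hsur : ∀ p, ∃ φ, p ∈ S.annulus E₀ → A.chart (S.H₀ p, φ) = p := fun p => by
    by_cases hp : p ∈ S.annulus E₀
    · exact (A.exists_chart_eq hp).imp fun φ hφ _ => hφ
    · exact ⟨0, fun h => absurd h hp⟩
  choose θ hθ using hsur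
  have hW : ∀ E ∈ Ioo 0 E₀, ∀ φ, h (S.H₀ (A.chart (E, φ))) (θ (A.chart (E, φ))) = h E φ := by
    intro E hE φ
    have h1 := hθ _ (A.chart_mem_annulus hE φ)
    rw [(A.chart_mem_levelCurve hE φ).2] at h1 ⊢
    exact eq_of_periodic_of_injOn Real.two_pi_pos (A.periodic E hE) (A.injOn E hE) (hper E hE) h1
  refine ⟨fun p => h (S.H₀ p) (θ p), fun p hp => ContDiffAt.contDiffWithinAt ?_, hW⟩
  have hE : (S.H₀ p, θ p).1 ∈ Ioo 0 E₀ := hp.2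
  have hp' := hθ p hp
  set a : ℝ × ℝ := (S.H₀ p, θ p) with ha
  let e : (ℝ × ℝ) ≃L[ℝ] (ℝ × ℝ) :=
    (LinearEquiv.ofInjectiveEndo (fderiv ℝ A.chart a : (ℝ × ℝ) →ₗ[ℝ] (ℝ × ℝ))
      (A.fderiv_chart_injective hE)).toContinuousLinearEquiv
  have hc := A.contDiffAt_chart hE
  have he : HasFDerivAt A.chart (e : (ℝ × ℝ) →L[ℝ] (ℝ × ℝ)) a := by
    have : (e : (ℝ × ℝ) →L[ℝ] (ℝ × ℝ)) = fderiv ℝ A.chart a := by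
      ext <;> rfl
    rw [this]
    exact (hc.differentiableAt (by simp)).hasFDerivAt
  have hn : (∞ : WithTop ℕ∞) ≠ 0 := by simp
  have hinv := hc.to_localInverse he hn
  have hinv_a := hc.localInverse_apply_image he hn
  have hright := (hc.hasStrictFDerivAt' he hn).eventually_right_inverse
  set g := hc.localInverse he hn
  rw [hp'] at hinv hinv_a hright
  -- Near `p` the chosen angle may jump, but the function itself equals `h` composed with the smooth
  -- local inverse `g` of the chart.
  have hcomp : ContDiffAt ℝ ∞ (fun p' => h (g p').1 (g p').2) p := by
    refine ContDiffAt.comp (g := fun a : ℝ × ℝ => h a.1 a.2) (f := g) p ?_ hinv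
    rw [hinv_a]
    exact hh.contDiffAt ((isOpen_Ioo.prod isOpen_univ).mem_nhds ⟨hE, trivial⟩)
  refine hcomp.congr_of_eventuallyEq ?_
  have hgI : ∀ᶠ p' in 𝓝 p, (g p').1 ∈ Ioo 0 E₀ := by
    refine (continuous_fst.continuousAt.comp hinv.continuousAt).eventually_mem ?_
    simp only [Function.comp_def, hinv_a]
    exact isOpen_Ioo.mem_nhds hE
  filter_upwards [hright, hgI] with p' h1 h2
  have h3 := hW _ h2 (g p').2
  have h4 : A.chart ((g p').1, (g p').2) = p' := h1
  rwa [h4] at h3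

end ActionAngle

theorem periodic_deriv {h : ℝ → ℝ} {T : ℝ} (hh : Function.Periodic h T) :
    Function.Periodic (deriv h) T := fun x => by
  rw [← deriv_comp_add_const]
  congr 1
  exact funext hh

/-! ### Smoothness and periodicity of the coefficients up to order n. -/

namespace ActionAngle

variable {S : System} {E₀ : ℝ} (A : ActionAngle S E₀)

theorem periodic_comp_chart (W : ℝ × ℝ → ℝ) {E : ℝ} (hE : E ∈ Ioo 0 E₀) :
    Function.Periodic (fun φ => W (A.X E φ, A.Y E φ)) (2 * Real.pi) :=
  fun φ => congrArg W (A.periodic E hE φ)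

theorem periodic_X {E : ℝ} (hE : E ∈ Ioo 0 E₀) : Function.Periodic (A.X E) (2 * Real.pi) :=
  A.periodic_comp_chart Prod.fst hE

theorem periodic_deriv_fst {h : ℝ → ℝ → ℝ}
    (hh : ∀ E ∈ Ioo 0 E₀, Function.Periodic (h E) (2 * Real.pi)) {E : ℝ} (hE : E ∈ Ioo 0 E₀) :
    Function.Periodic (fun φ => deriv (fun e => h e φ) E) (2 * Real.pi) := fun φ => by
  refine EventuallyEq.deriv_eq ?_
  filter_upwards [isOpen_Ioo.mem_nhds hE] with e he using hh e he φ

theorem contDiffOn_comp_chart {W : ℝ × ℝ → ℝ} (hW : ContDiffOn ℝ ∞ W S.D) :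
    ContDiffOn ℝ ∞ (fun a : ℝ × ℝ => W (A.X a.1 a.2, A.Y a.1 a.2)) (Ioo 0 E₀ ×ˢ univ) :=
  hW.comp A.contDiffOn_chart fun a ha => (A.chart_mem_annulus ha.1 a.2).1

theorem contDiffOn_freq_fst :
    ContDiffOn ℝ ∞ (fun a : ℝ × ℝ => A.freq a.1) (Ioo 0 E₀ ×ˢ univ) :=
  A.contDiffOn_freq.comp contDiffOn_fst fun _ ha => ha.1

theorem contDiffOn_f {k : ℕ} (hk : 1 ≤ k) :
    ContDiffOn ℝ ∞ (fun a : ℝ × ℝ => A.f k a.1 a.2) (Ioo 0 E₀ ×ˢ univ) :=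
  A.contDiffOn_freq_fst.neg.mul
    ((contDiffOn_deriv_snd (h := fun e ψ => S.Hk k (A.X e ψ, A.Y e ψ)) isOpen_Ioo
      (A.contDiffOn_comp_chart (S.smooth_Hk k hk))).sub
    ((A.contDiffOn_comp_chart (S.smooth_Fk k hk)).mul
      (contDiffOn_deriv_snd isOpen_Ioo A.smooth_X)))

theorem contDiffOn_g {k : ℕ} (hk : 1 ≤ k) :
    ContDiffOn ℝ ∞ (fun a : ℝ × ℝ => A.g k a.1 a.2) (Ioo 0 E₀ ×ˢ univ) :=
  A.contDiffOn_freq_fst.mul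
    ((contDiffOn_deriv_fst (h := fun e ψ => S.Hk k (A.X e ψ, A.Y e ψ)) isOpen_Ioo
      (A.contDiffOn_comp_chart (S.smooth_Hk k hk))).sub
    ((A.contDiffOn_comp_chart (S.smooth_Fk k hk)).mul
      (contDiffOn_deriv_fst isOpen_Ioo A.smooth_X)))

theorem periodic_f (k : ℕ) {E : ℝ} (hE : E ∈ Ioo 0 E₀) :
    Function.Periodic (A.f k E) (2 * Real.pi) := fun φ => by
  have h := A.periodic_comp_chart (S.Fk k) hE φ
  simp only at h
  unfold f
  rw [periodic_deriv (A.periodic_comp_chart (S.Hk k) hE) φ,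
    periodic_deriv (A.periodic_X hE) φ, h]

theorem periodic_g (k : ℕ) {E : ℝ} (hE : E ∈ Ioo 0 E₀) :
    Function.Periodic (A.g k E) (2 * Real.pi) := fun φ => by
  have h1 := periodic_deriv_fst (h := fun e ψ => S.Hk k (A.X e ψ, A.Y e ψ))
    (fun E hE => A.periodic_comp_chart (S.Hk k) hE) hE φ
  have h2 := periodic_deriv_fst (h := A.X) (fun E hE => A.periodic_X hE) hE φ
  have h3 := A.periodic_comp_chart (S.Fk k) hE φ
  simp only at h1 h2 h3
  unfold g
  rw [h1, h2, h3]

/-- If the lower coefficients `Λ_j` vanish, only the transport terms remain in `Z_k`, `k ≤ q`. -/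
theorem Z_eq_of_Lam_eq_zero {k : ℕ} (hkq : k ≤ S.q)
    (hlow : ∀ j, 1 ≤ j → j < k → ∀ E ∈ Ioo 0 E₀, A.Lam j E = 0) {E : ℝ} (hE : E ∈ Ioo 0 E₀)
    (φ : ℝ) :
    A.Z k E φ = -∑ i ∈ Finset.Ico 1 k, (A.f (k - i) E φ * deriv (fun e => A.v i e φ) E
      + A.g (k - i) E φ * deriv (A.v i E) φ) := by
  unfold Z Zfun
  rw [if_neg (by omega), add_zero, Finset.sum_eq_zero, zero_sub]
  intro j hj
  rw [Finset.mem_Ico] at hj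
  refine Finset.sum_eq_zero fun m _ => ?_
  -- `Lam j` vanishes only on the open interval, so its derivatives are computed from local
  -- equality.
  have h1 : A.Lam j =ᶠ[𝓝 E] fun _ => 0 := by
    filter_upwards [isOpen_Ioo.mem_nhds hE] with e he using hlow j hj.1 hj.2 e he
  rw [h1.iteratedDeriv_eq m]
  have h2 : iteratedDeriv m (fun _ : ℝ => (0 : ℝ)) E = 0 := by
    rw [iteratedDeriv_const]
    split_ifs <;> rfl
  rw [h2, zero_div, zero_mul]

/-- The results on index k are conditional on the smaller indices; `contDiffOn_v_and_periodic`
discharges these conditions by strong induction. -/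
theorem contDiffOn_Z_of_contDiffOn {k : ℕ} (hkq : k ≤ S.q)
    (hlow : ∀ j, 1 ≤ j → j < k → ∀ E ∈ Ioo 0 E₀, A.Lam j E = 0)
    (hv : ∀ j, 1 ≤ j → j < k →
      ContDiffOn ℝ ∞ (fun a : ℝ × ℝ => A.v j a.1 a.2) (Ioo 0 E₀ ×ˢ univ)) :
    ContDiffOn ℝ ∞ (fun a : ℝ × ℝ => A.Z k a.1 a.2) (Ioo 0 E₀ ×ˢ univ) := by
  refine ContDiffOn.congr (ContDiffOn.neg (ContDiffOn.sum (s := Finset.Ico 1 k)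
    fun i hi => ?_)) fun a ha => A.Z_eq_of_Lam_eq_zero hkq hlow ha.1 a.2
  rw [Finset.mem_Ico] at hi
  have := hv i hi.1 hi.2
  exact ((A.contDiffOn_f (by omega)).mul (contDiffOn_deriv_fst isOpen_Ioo this)).add
    ((A.contDiffOn_g (by omega)).mul (contDiffOn_deriv_snd isOpen_Ioo this))

theorem periodic_Z_of_periodic {k : ℕ} (hkq : k ≤ S.q)
    (hlow : ∀ j, 1 ≤ j → j < k → ∀ E ∈ Ioo 0 E₀, A.Lam j E = 0)
    (hv : ∀ j, 1 ≤ j → j < k → ∀ E ∈ Ioo 0 E₀, Function.Periodic (A.v j E) (2 * Real.pi))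
    {E : ℝ} (hE : E ∈ Ioo 0 E₀) : Function.Periodic (A.Z k E) (2 * Real.pi) := fun φ => by
  rw [A.Z_eq_of_Lam_eq_zero hkq hlow hE, A.Z_eq_of_Lam_eq_zero hkq hlow hE]
  congr 1
  refine Finset.sum_congr rfl fun i hi => ?_
  rw [Finset.mem_Ico] at hi
  have := hv i hi.1 hi.2
  have h1 := periodic_deriv_fst this hE φ
  simp only at h1
  rw [A.periodic_f _ hE, A.periodic_g _ hE, periodic_deriv (this E hE), h1]

theorem contDiffOn_Lam_of_contDiffOn_Z {k : ℕ} (hk : 1 ≤ k)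
    (hZ : ContDiffOn ℝ ∞ (fun a : ℝ × ℝ => A.Z k a.1 a.2) (Ioo 0 E₀ ×ˢ univ)) :
    ContDiffOn ℝ ∞ (A.Lam k) (Ioo 0 E₀) :=
  ((contDiffOn_avg isOpen_Ioo (A.contDiffOn_f hk)).sub (contDiffOn_avg isOpen_Ioo hZ)).congr
    fun E _ => A.Lam_eq hk E

/-- The integrand in the definition of `v_k`. -/
def vIntegrand (k : ℕ) (E ψ : ℝ) : ℝ :=
  A.Lam k E - A.freq E * S.Fk k (A.X E ψ, A.Y E ψ) * deriv (fun ψ' => A.X E ψ') ψ + A.Z k E ψ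

theorem contDiffOn_vIntegrand {k : ℕ} (hk : 1 ≤ k)
    (hZ : ContDiffOn ℝ ∞ (fun a : ℝ × ℝ => A.Z k a.1 a.2) (Ioo 0 E₀ ×ˢ univ)) :
    ContDiffOn ℝ ∞ (fun a : ℝ × ℝ => A.vIntegrand k a.1 a.2) (Ioo 0 E₀ ×ˢ univ) :=
  (((A.contDiffOn_Lam_of_contDiffOn_Z hk hZ).comp contDiffOn_fst fun _ ha => ha.1).sub
    ((A.contDiffOn_freq_fst.mul (A.contDiffOn_comp_chart (S.smooth_Fk k hk))).mul
      (contDiffOn_deriv_snd isOpen_Ioo A.smooth_X))).add hZ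

theorem contDiffOn_v_of_contDiffOn_Z {k : ℕ} (hk : 1 ≤ k)
    (hZ : ContDiffOn ℝ ∞ (fun a : ℝ × ℝ => A.Z k a.1 a.2) (Ioo 0 E₀ ×ˢ univ)) :
    ContDiffOn ℝ ∞ (fun a : ℝ × ℝ => A.v k a.1 a.2) (Ioo 0 E₀ ×ˢ univ) := by
  refine ((A.contDiffOn_comp_chart (S.smooth_Hk k hk)).add ((contDiffOn_const (c := (1 : ℝ))).div
    A.contDiffOn_freq_fst (fun a ha => (A.freq_pos _ ha.1).ne') |>.mul
    (contDiffOn_primitive isOpen_Ioo (A.contDiffOn_vIntegrand hk hZ)))).congr fun a _ => ?_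
  exact A.v_eq hk a.1 a.2

/-- The F_k term is f_k up to a φ-derivative of H_k. That derivative cancels the term H_k in v_k, up
to its value at φ = 0. -/
theorem vIntegrand_eq (k : ℕ) (E ψ : ℝ) : A.vIntegrand k E ψ = A.Lam k E - A.f k E ψ
    + A.Z k E ψ - A.freq E * deriv (fun ψ => S.Hk k (A.X E ψ, A.Y E ψ)) ψ := by
  unfold vIntegrand f
  ring

/-- The homological equation for `v_k`. -/
theorem freq_mul_deriv_v {k : ℕ} (hk : 1 ≤ k)
    (hZ : ContDiffOn ℝ ∞ (fun a : ℝ × ℝ => A.Z k a.1 a.2) (Ioo 0 E₀ ×ˢ univ))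
    {E : ℝ} (hE : E ∈ Ioo 0 E₀) (φ : ℝ) :
    A.freq E * deriv (A.v k E) φ = A.Lam k E - A.f k E φ + A.Z k E φ := by
  have hc := continuous_snd_of_contDiffOn (A.contDiffOn_vIntegrand hk hZ) hE
  have h1 := (hasDerivAt_snd_of_contDiffOn (h := fun e ψ => S.Hk k (A.X e ψ, A.Y e ψ)) isOpen_Ioo
    (A.contDiffOn_comp_chart (S.smooth_Hk k hk)) hE φ).differentiableAt.hasDerivAt
  have h2 := intervalIntegral.integral_hasDerivAt_right (hc.intervalIntegrable 0 φ)
    hc.stronglyMeasurable.stronglyMeasurableAtFilter hc.continuousAt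
  have h3 := (h1.add (h2.const_mul (1 / A.freq E))).congr_of_eventuallyEq
    (Eventually.of_forall fun ψ => A.v_eq hk E ψ)
  have hω := (A.freq_pos E hE).ne'
  rw [h3.deriv, vIntegrand_eq]
  field_simp
  ring

/-- The integrand is periodic, so its primitive is periodic exactly when the mean vanishes; Λ_k =
⟨f_k⟩ - ⟨Z_k⟩ is this condition, as the derivative of the periodic H_k has mean zero. -/
theorem periodic_v_of_periodic_Z {k : ℕ} (hk : 1 ≤ k)
    (hZ : ContDiffOn ℝ ∞ (fun a : ℝ × ℝ => A.Z k a.1 a.2) (Ioo 0 E₀ ×ˢ univ))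
    {E : ℝ} (hE : E ∈ Ioo 0 E₀) (hper : Function.Periodic (A.Z k E) (2 * Real.pi)) :
    Function.Periodic (A.v k E) (2 * Real.pi) := fun φ => by
  have hc := continuous_snd_of_contDiffOn (A.contDiffOn_vIntegrand hk hZ) hE
  have hcH := contDiffOn_deriv_snd (h := fun e ψ => S.Hk k (A.X e ψ, A.Y e ψ)) isOpen_Ioo
    (A.contDiffOn_comp_chart (S.smooth_Hk k hk))
  have hH := A.periodic_comp_chart (S.Hk k) hE
  have hvper : Function.Periodic (A.vIntegrand k E) (2 * Real.pi) := fun ψ => by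
    rw [vIntegrand_eq, vIntegrand_eq, A.periodic_f k hE, hper ψ, periodic_deriv hH]
  have hcf := (continuous_snd_of_contDiffOn (A.contDiffOn_f hk) hE).intervalIntegrable
    (μ := MeasureTheory.volume) 0 (2 * Real.pi)
  have hcZ := (continuous_snd_of_contDiffOn hZ hE).intervalIntegrable
    (μ := MeasureTheory.volume) 0 (2 * Real.pi)
  have hcd := (continuous_snd_of_contDiffOn
    (h := fun e φ => deriv (fun ψ => S.Hk k (A.X e ψ, A.Y e ψ)) φ) hcH hE).intervalIntegrable
    (μ := MeasureTheory.volume) 0 (2 * Real.pi)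
  have hint : ∫ ψ in (0)..(2 * Real.pi), A.vIntegrand k E ψ = 0 := by
    simp only [vIntegrand_eq]
    rw [intervalIntegral.integral_sub ((intervalIntegrable_const.sub hcf).add hcZ)
        (hcd.const_mul _), intervalIntegral.integral_add (intervalIntegrable_const.sub hcf) hcZ,
      intervalIntegral.integral_sub intervalIntegrable_const hcf,
      intervalIntegral.integral_const_mul, intervalIntegral.integral_deriv_eq_sub
        (fun ψ _ => (hasDerivAt_snd_of_contDiffOn (h := fun e ψ => S.Hk k (A.X e ψ, A.Y e ψ))
          isOpen_Ioo (A.contDiffOn_comp_chart (S.smooth_Hk k hk)) hE ψ).differentiableAt) hcd]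
    have h0 : S.Hk k (A.X E (2 * Real.pi), A.Y E (2 * Real.pi)) = S.Hk k (A.X E 0, A.Y E 0) := by
      simpa using hH 0
    rw [h0, A.Lam_eq hk]
    simp only [avg, intervalIntegral.integral_const, sub_zero, smul_eq_mul]
    field_simp
    ring
  have hsplit : ∫ ψ in (0)..(φ + 2 * Real.pi), A.vIntegrand k E ψ
      = ∫ ψ in (0)..φ, A.vIntegrand k E ψ := by
    rw [← intervalIntegral.integral_add_adjacent_intervals (hc.intervalIntegrable 0 φ)
      (hc.intervalIntegrable φ _), hvper.intervalIntegral_add_eq φ 0, zero_add, hint, add_zero]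
  have h0 := hH φ
  simp only at h0
  rw [A.v_eq hk, A.v_eq hk, h0]
  congr 2

theorem contDiffOn_v_and_periodic {n : ℕ} (hnq : n ≤ S.q)
    (hlow : ∀ k, 1 ≤ k → k < n → ∀ E ∈ Ioo 0 E₀, A.Lam k E = 0) {k : ℕ} (hk : 1 ≤ k)
    (hkn : k ≤ n) :
    ContDiffOn ℝ ∞ (fun a : ℝ × ℝ => A.v k a.1 a.2) (Ioo 0 E₀ ×ˢ univ) ∧
      ∀ E ∈ Ioo 0 E₀, Function.Periodic (A.v k E) (2 * Real.pi) := by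
  induction k using Nat.strong_induction_on with
  | _ k ih =>
    have hl : ∀ j, 1 ≤ j → j < k → ∀ E ∈ Ioo 0 E₀, A.Lam j E = 0 :=
      fun j h1 h2 => hlow j h1 (by omega)
    have hZ := A.contDiffOn_Z_of_contDiffOn (hkn.trans hnq) hl
      fun j h1 h2 => (ih j h2 h1 (by omega)).1
    refine ⟨A.contDiffOn_v_of_contDiffOn_Z hk hZ, fun E hE => ?_⟩
    exact A.periodic_v_of_periodic_Z hk hZ hE (A.periodic_Z_of_periodic (hkn.trans hnq) hl
      (fun j h1 h2 => (ih j h2 h1 (by omega)).2) hE)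

end ActionAngle

/-! ### The averaging identities and the corrected energy. -/

namespace ActionAngle

variable {S : System} {E₀ : ℝ} (A : ActionAngle S E₀)

/-- The limiting field in terms of energy and angle. -/
theorem fderiv_apply_fieldCoeff_zero {W : ℝ × ℝ → ℝ} {h : ℝ → ℝ → ℝ} {E φ : ℝ}
    (hE : E ∈ Ioo 0 E₀) (hW : DifferentiableAt ℝ W (A.chart (E, φ)))
    (hh : ∀ e ∈ Ioo 0 E₀, ∀ ψ, W (A.chart (e, ψ)) = h e ψ) :
    fderiv ℝ W (A.chart (E, φ)) (S.fieldCoeff 0 (A.chart (E, φ)))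
      = A.freq E * deriv (h E) φ := by
  rw [fderiv_apply_eq, (A.deriv_comp_chart hE hW hh).2]
  have h2 := A.eq_X E hE φ
  have h3 := A.eq_Y E hE φ
  simp only [System.fieldCoeff, if_true, System.limitField, chart] at *
  rw [← h2, ← h3]
  ring

/-- The coefficients of the field in terms of energy and angle. -/
theorem fderiv_apply_fieldCoeff {W : ℝ × ℝ → ℝ} {h : ℝ → ℝ → ℝ} {E φ : ℝ}
    (hE : E ∈ Ioo 0 E₀) (hW : DifferentiableAt ℝ W (A.chart (E, φ)))
    (hh : ∀ e ∈ Ioo 0 E₀, ∀ ψ, W (A.chart (e, ψ)) = h e ψ) {k : ℕ} (hk : 1 ≤ k) :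
    fderiv ℝ W (A.chart (E, φ)) (S.fieldCoeff k (A.chart (E, φ)))
      = A.f k E φ * deriv (fun e => h e φ) E + A.g k E φ * deriv (h E) φ := by
  have hD := (A.chart_mem_annulus hE φ).1
  have hH := A.deriv_comp_chart (W := S.Hk k) (h := fun e ψ => S.Hk k (A.X e ψ, A.Y e ψ)) (φ := φ)
    hE (((S.smooth_Hk k hk).contDiffAt (S.isOpen_D.mem_nhds hD)).differentiableAt (by simp))
    fun _ _ _ => rfl
  have hdet := A.freq_mul_det hE φ
  rw [fderiv_apply_eq, (A.deriv_comp_chart hE hW hh).1, (A.deriv_comp_chart hE hW hh).2, f, g,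
    hH.1, hH.2]
  simp only [System.fieldCoeff, if_neg (show k ≠ 0 by omega), chart]
  -- The coefficient is the derivative of `W` along `fieldCoeff k`; expanding f_k and g_k reproduces
  -- it times -ω·det = 1.
  linear_combination (dx W (A.X E φ, A.Y E φ) * dy (S.Hk k) (A.X E φ, A.Y E φ)
    - dy W (A.X E φ, A.Y E φ) * (dx (S.Hk k) (A.X E φ, A.Y E φ) - S.Fk k (A.X E φ, A.Y E φ))) * hdet

/-- Averaging: functions on the annulus which bring the energy equation into its averaged form up
to order `n`. -/
theorem exists_averaging {n : ℕ} (hn : 1 ≤ n) (hnq : n ≤ S.q)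
    (hlow : ∀ k, 1 ≤ k → k < n → ∀ E ∈ Ioo 0 E₀, A.Lam k E = 0) :
    ∃ W : ℕ → ℝ × ℝ → ℝ, W 0 = S.H₀ ∧ (∀ k ≤ n, ContDiffOn ℝ ∞ (W k) (S.annulus E₀)) ∧
      ∀ p ∈ S.annulus E₀, ∀ m ≤ n, ∑ k ∈ Finset.range (m + 1),
        fderiv ℝ (W k) p (S.fieldCoeff (m - k) p) = if m = n then A.Lam n (S.H₀ p) else 0 := by
  have hex : ∀ k, ∃ W : ℝ × ℝ → ℝ, (k = 0 → W = S.H₀) ∧ (k ≤ n → ContDiffOn ℝ ∞ W (S.annulus E₀) ∧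
      ∀ E ∈ Ioo 0 E₀, ∀ φ, W (A.chart (E, φ)) = if k = 0 then E else A.v k E φ) := fun k => by
    rcases Nat.eq_zero_or_pos k with rfl | hk
    · refine ⟨S.H₀, fun _ => rfl, fun _ => ⟨S.smooth_H₀.mono fun p hp => hp.1, fun E hE φ => ?_⟩⟩
      simpa using (A.chart_mem_levelCurve hE φ).2
    · by_cases hkn : k ≤ n
      · obtain ⟨h1, h2⟩ := A.contDiffOn_v_and_periodic hnq hlow hk hkn
        obtain ⟨W, hW1, hW2⟩ := A.exists_descent h1 h2
        refine ⟨W, fun h => by omega, fun _ => ⟨hW1, fun E hE φ => ?_⟩⟩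
        rw [if_neg (by omega), hW2 E hE φ]
      · exact ⟨0, fun h => by omega, fun h => absurd h hkn⟩
  choose W hW0 hW using hex
  refine ⟨W, hW0 0 rfl, fun k hk => (hW k hk).1, fun p hp m hm => ?_⟩
  obtain ⟨φ, hφ⟩ := A.exists_chart_eq hp
  have hE := hp.2
  set E := S.H₀ p
  have hdiff : ∀ k ≤ n, DifferentiableAt ℝ (W k) (A.chart (E, φ)) := fun k hk => by
    rw [hφ]
    exact ((hW k hk).1.contDiffAt ((S.isOpen_annulus E₀).mem_nhds hp)).differentiableAt (by simp)
  rw [← hφ]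
  rcases Nat.eq_zero_or_pos m with rfl | hm0
  · rw [Finset.sum_range_one, A.fderiv_apply_fieldCoeff_zero (h := fun e _ => e) hE
      (hdiff 0 hm) fun e he ψ => by simpa using (hW 0 hm).2 e he ψ, if_neg (by omega)]
    simp
  have hv : ∀ k, 1 ≤ k → k ≤ n → ∀ e ∈ Ioo 0 E₀, ∀ ψ, W k (A.chart (e, ψ)) = A.v k e ψ :=
    fun k h1 h2 e he ψ => by rw [(hW k h2).2 e he ψ, if_neg (by omega)]
  have hZ := A.contDiffOn_Z_of_contDiffOn (hm.trans hnq) (fun j h1 h2 => hlow j h1 (by omega))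
    fun j h1 h2 => (A.contDiffOn_v_and_periodic hnq hlow h1 (by omega)).1
  have hZeq := A.Z_eq_of_Lam_eq_zero (hm.trans hnq) (fun j h1 h2 => hlow j h1 (by omega)) hE φ
  have hhom := A.freq_mul_deriv_v hm0 hZ hE φ
  have hmid : ∑ k ∈ Finset.Ico 1 m,
      fderiv ℝ (W k) (A.chart (E, φ)) (S.fieldCoeff (m - k) (A.chart (E, φ))) = -A.Z m E φ := by
    rw [hZeq, neg_neg]
    refine Finset.sum_congr rfl fun k hk => ?_
    rw [Finset.mem_Ico] at hk
    exact A.fderiv_apply_fieldCoeff hE (hdiff k (by omega)) (hv k hk.1 (by omega)) (by omega)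
  have hzero : fderiv ℝ (W 0) (A.chart (E, φ)) (S.fieldCoeff m (A.chart (E, φ))) = A.f m E φ := by
    rw [A.fderiv_apply_fieldCoeff (h := fun e _ => e) hE (hdiff 0 (by omega))
      (fun e he ψ => by simpa using (hW 0 (by omega)).2 e he ψ) hm0]
    simp
  -- The three parts of the sum are f_m from k = 0, -Z_m from the middle, and ω ∂_φ v_m = Λ_m - f_m
  -- + Z_m from k = m; only Λ_m survives.
  rw [Finset.sum_range_succ, Nat.sub_self, A.fderiv_apply_fieldCoeff_zero hE (hdiff m hm)
    (hv m hm0 hm), Finset.range_eq_Ico, Finset.sum_eq_sum_Ico_succ_bot hm0, zero_add, Nat.sub_zero,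
    hmid, hzero, hhom]
  split_ifs with hmn
  · rw [hmn]; ring
  · rw [hlow m hm0 (by omega) E hE]; ring

end ActionAngle

/-- The product of two polynomials in `s`, truncated at order `n`. -/
theorem abs_sum_mul_sub_le {n : ℕ} {a : ℕ → ℕ → ℝ} {s L : ℝ} (hs0 : 0 ≤ s) (hs1 : s ≤ 1)
    (ha : ∀ m ≤ n, ∑ k ∈ Finset.range (m + 1), a k (m - k) = if m = n then L else 0) :
    |∑ k ∈ Finset.range (n + 1), s ^ k * ∑ i ∈ Finset.range (n + 1), s ^ i * a k i - s ^ n * L|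
      ≤ s ^ (n + 1) * ∑ k ∈ Finset.range (n + 1), ∑ i ∈ Finset.range (n + 1), |a k i| := by
  -- The terms with k + i ≤ n, regrouped by m = k + i; those left over in `h3` have order at least n
  -- + 1.
  have h1 : ∑ k ∈ Finset.range (n + 1), ∑ i ∈ Finset.range (n + 1 - k), s ^ (k + i) * a k i
      = s ^ n * L := by
    rw [← Finset.sum_range_diag_flip (n + 1) fun k i => s ^ (k + i) * a k i]
    have : ∀ m ∈ Finset.range (n + 1), ∑ k ∈ Finset.range (m + 1), s ^ (k + (m - k)) * a k (m - k)
        = if m = n then s ^ n * L else 0 := fun m hm => by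
      have h2 : ∑ k ∈ Finset.range (m + 1), s ^ (k + (m - k)) * a k (m - k)
          = s ^ m * ∑ k ∈ Finset.range (m + 1), a k (m - k) := by
        rw [Finset.mul_sum]
        refine Finset.sum_congr rfl fun k hk => ?_
        rw [Finset.mem_range] at hk
        rw [show k + (m - k) = m by omega]
      rw [h2, ha m (by simpa [Nat.lt_succ_iff] using hm)]
      split_ifs with h
      · rw [h]
      · simp
    rw [Finset.sum_congr rfl this]
    simp
  have h3 : ∑ k ∈ Finset.range (n + 1), s ^ k * ∑ i ∈ Finset.range (n + 1), s ^ i * a k i - s ^ n * L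
      = ∑ k ∈ Finset.range (n + 1), ∑ i ∈ Finset.Ico (n + 1 - k) (n + 1), s ^ (k + i) * a k i := by
    rw [← h1, ← Finset.sum_sub_distrib]
    refine Finset.sum_congr rfl fun k hk => ?_
    rw [Finset.range_eq_Ico, Finset.range_eq_Ico,
      ← Finset.sum_Ico_consecutive _ (Nat.zero_le (n + 1 - k)) (Nat.sub_le _ _), mul_add,
      Finset.mul_sum, Finset.mul_sum]
    simp only [pow_add, mul_assoc, add_sub_cancel_left]
  rw [h3, Finset.mul_sum]
  refine (Finset.abs_sum_le_sum_abs _ _).trans (Finset.sum_le_sum fun k hk => ?_)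
  rw [Finset.mul_sum]
  refine (Finset.abs_sum_le_sum_abs _ _).trans ((Finset.sum_le_sum fun i hi => ?_).trans
    (Finset.sum_le_sum_of_subset_of_nonneg (t := Finset.range (n + 1)) ?_
      fun i _ _ => mul_nonneg (pow_nonneg hs0 _) (abs_nonneg (a k i))))
  · rw [Finset.mem_Ico] at hi
    rw [abs_mul, abs_of_nonneg (pow_nonneg hs0 _)]
    exact mul_le_mul_of_nonneg_right (pow_le_pow_of_le_one hs0 hs1 (by omega)) (abs_nonneg _)
  · intro i hi
    rw [Finset.mem_Ico] at hi
    exact Finset.mem_range.2 hi.2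

theorem rpow_neg_one_div_pow {t : ℝ} (ht : 0 ≤ t) (q k : ℕ) :
    (t ^ (-1 / (q : ℝ))) ^ k = t ^ (-(k : ℝ) / q) := by
  rw [← Real.rpow_natCast, ← Real.rpow_mul ht]
  congr 1
  ring

namespace System

variable (S : System)

/-- The small parameter `t^{-1/q}`. -/
def small (t : ℝ) : ℝ := t ^ (-1 / (S.q : ℝ))

theorem small_pos {t : ℝ} (ht : 0 < t) : 0 < S.small t := Real.rpow_pos_of_pos ht _

theorem small_le_one {t : ℝ} (ht : 1 ≤ t) : S.small t ≤ 1 :=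
  Real.rpow_le_one_of_one_le_of_nonpos ht
    (div_nonpos_of_nonpos_of_nonneg (by norm_num) (Nat.cast_nonneg _))

theorem small_pow_q {t : ℝ} (ht : 0 < t) : S.small t ^ S.q = t⁻¹ := by
  have hq : (S.q : ℝ) ≠ 0 := Nat.cast_ne_zero.2 S.q_pos.ne'
  rw [small, rpow_neg_one_div_pow ht.le, neg_div, div_self hq, Real.rpow_neg_one]

theorem tendsto_small : Tendsto S.small atTop (𝓝 0) := by
  have hq : (0 : ℝ) < S.q := Nat.cast_pos.2 S.q_pos
  have := tendsto_rpow_neg_atTop (one_div_pos.2 hq)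
  simp only [← neg_div] at this
  exact this

theorem antitoneOn_small : AntitoneOn S.small (Ioi 0) := fun _ hx _ _ hxy =>
  Real.rpow_le_rpow_of_nonpos hx hxy
    (div_nonpos_of_nonpos_of_nonneg (by norm_num) (Nat.cast_nonneg _))

theorem hasDerivAt_small_pow {t : ℝ} (ht : 0 < t) (k : ℕ) :
    HasDerivAt (fun t => S.small t ^ k) (-(k / S.q) * S.small t ^ k * t⁻¹) t := by
  have h1 : HasDerivAt (fun t : ℝ => t ^ (-(k : ℝ) / S.q))
      (-(k : ℝ) / S.q * t ^ (-(k : ℝ) / S.q - 1)) t := Real.hasDerivAt_rpow_const (Or.inl ht.ne')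
  have h2 : HasDerivAt (fun t => S.small t ^ k) _ t := h1.congr_of_eventuallyEq (by
    filter_upwards [eventually_gt_nhds ht] with r hr using rpow_neg_one_div_pow hr.le _ _)
  convert h2 using 1
  rw [small, rpow_neg_one_div_pow ht.le, Real.rpow_sub_one ht.ne']
  ring

theorem norm_field_sub_le {K : Set (ℝ × ℝ)} (hK : IsCompact K) (hKD : K ⊆ S.D) (N : ℕ) :
    ∃ C ≥ 0, ∃ T ≥ 1, ∀ t ≥ T, ∀ p ∈ K,
      ‖S.field t p - ∑ i ∈ Finset.range (N + 1), S.small t ^ i • S.fieldCoeff i p‖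
        ≤ C * S.small t ^ (N + 1) := by
  obtain ⟨C₁, T₁, hT₁, h₁⟩ := S.expansion_dx K hK hKD N
  obtain ⟨C₂, T₂, hT₂, h₂⟩ := S.expansion_dy K hK hKD N
  obtain ⟨C₃, T₃, hT₃, h₃⟩ := S.expansion_F K hK hKD N
  refine ⟨|C₁| + |C₂| + |C₃|, by positivity, max 1 (max T₁ (max T₂ T₃)), le_max_left _ _,
    fun t ht p hp => ?_⟩
  simp only [ge_iff_le, max_le_iff] at ht
  obtain ⟨ht1, htT₁, htT₂, htT₃⟩ := ht
  have ht0 : 0 < t := by linarith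
  have hpow : ∀ k : ℕ, t ^ (-(k : ℝ) / S.q) = S.small t ^ k := fun k =>
    (rpow_neg_one_div_pow ht0.le _ _).symm
  have hpow' : t ^ (-((N : ℝ) + 1) / S.q) = S.small t ^ (N + 1) := by
    rw [← hpow]; push_cast; rfl
  specialize h₁ t htT₁ p hp
  specialize h₂ t htT₂ p hp
  specialize h₃ t htT₃ p hp
  simp only [hpow, hpow'] at h₁ h₂ h₃
  have hs : 0 ≤ S.small t ^ (N + 1) := pow_nonneg (S.small_pos ht0).le _
  have e₁ := h₁.trans (mul_le_mul_of_nonneg_right (le_abs_self C₁) hs)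
  have e₂ := h₂.trans (mul_le_mul_of_nonneg_right (le_abs_self C₂) hs)
  have e₃ := h₃.trans (mul_le_mul_of_nonneg_right (le_abs_self C₃) hs)
  have n₁ : 0 ≤ |C₁| * S.small t ^ (N + 1) := by positivity
  have n₂ : 0 ≤ |C₂| * S.small t ^ (N + 1) := by positivity
  have n₃ : 0 ≤ |C₃| * S.small t ^ (N + 1) := by positivity
  have hsum : ∑ i ∈ Finset.range (N + 1), S.small t ^ i • S.fieldCoeff i p
      = (dy S.H₀ p + ∑ k ∈ Finset.Icc 1 N, S.small t ^ k * dy (S.Hk k) p,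
        -dx S.H₀ p - ∑ k ∈ Finset.Icc 1 N, S.small t ^ k * dx (S.Hk k) p
          + ∑ k ∈ Finset.Icc 1 N, S.small t ^ k * S.Fk k p) := by
    rw [Finset.range_eq_Ico, Finset.sum_eq_sum_Ico_succ_bot (Nat.add_one_pos N), zero_add,
      Finset.Ico_add_one_right_eq_Icc]
    have : ∀ k ∈ Finset.Icc 1 N, S.small t ^ k • S.fieldCoeff k p
        = (S.small t ^ k * dy (S.Hk k) p,
          -(S.small t ^ k * dx (S.Hk k) p) + S.small t ^ k * S.Fk k p) := fun k hk => by
      rw [Finset.mem_Icc] at hk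
      rw [fieldCoeff, if_neg (by omega)]
      ext <;> simp [mul_add]
    rw [Finset.sum_congr rfl this]
    ext
    · simp [fieldCoeff, limitField, Prod.fst_sum]
    · simp only [pow_zero, fieldCoeff, if_true, limitField, one_smul, Prod.snd_add, Prod.snd_sum,
        Finset.sum_add_distrib, Finset.sum_neg_distrib]
      ring
  rw [hsum, Prod.norm_def]
  refine max_le ?_ ?_
  · have : (S.field t p - (dy S.H₀ p + ∑ k ∈ Finset.Icc 1 N, S.small t ^ k * dy (S.Hk k) p,
        -dx S.H₀ p - ∑ k ∈ Finset.Icc 1 N, S.small t ^ k * dx (S.Hk k) p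
          + ∑ k ∈ Finset.Icc 1 N, S.small t ^ k * S.Fk k p)).1
        = dy (fun p' => S.H p' t) p - dy S.H₀ p
          - ∑ k ∈ Finset.Icc 1 N, S.small t ^ k * dy (S.Hk k) p := by
      simp [field, sub_sub]
    rw [this, Real.norm_eq_abs]
    linarith
  · have : (S.field t p - (dy S.H₀ p + ∑ k ∈ Finset.Icc 1 N, S.small t ^ k * dy (S.Hk k) p,
        -dx S.H₀ p - ∑ k ∈ Finset.Icc 1 N, S.small t ^ k * dx (S.Hk k) p
          + ∑ k ∈ Finset.Icc 1 N, S.small t ^ k * S.Fk k p)).2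
        = -(dx (fun p' => S.H p' t) p - dx S.H₀ p
          - ∑ k ∈ Finset.Icc 1 N, S.small t ^ k * dx (S.Hk k) p)
          + (S.F p t - 0 - ∑ k ∈ Finset.Icc 1 N, S.small t ^ k * S.Fk k p) := by
      simp only [field, Prod.snd_sub]
      ring
    rw [this, Real.norm_eq_abs]
    refine (abs_add_le _ _).trans ?_
    rw [abs_neg]
    linarith

end System

namespace ActionAngle

variable {S : System} {E₀ : ℝ} (A : ActionAngle S E₀)

/-- Near the annulus, the energy can be corrected by terms of order `t^{-1/q}` to a function whose
derivative along the solutions is `t^{-n/q} Λ_n`, up to terms of order `t^{-(n+1)/q}`. -/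
theorem exists_lyapunov {n : ℕ} (hn : 1 ≤ n) (hnq : n ≤ S.q)
    (hlow : ∀ k, 1 ≤ k → k < n → ∀ E ∈ Ioo 0 E₀, A.Lam k E = 0) {K : Set (ℝ × ℝ)}
    (hK : IsCompact K) (hKU : K ⊆ S.annulus E₀) :
    ∃ u : ℝ → ℝ × ℝ → ℝ, ∃ C ≥ 0, ∃ T ≥ 1, ∀ t ≥ T,
      (∀ p ∈ K, |u t p - S.H₀ p| ≤ C * S.small t) ∧
      ∀ (z : ℝ → ℝ × ℝ) (Γ : Set ℝ), z t ∈ K → HasDerivWithinAt z (S.field t (z t)) Γ t →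
        ∃ d, HasDerivWithinAt (fun r => u r (z r)) d Γ t ∧
          |d - S.small t ^ n * A.Lam n (S.H₀ (z t))| ≤ C * S.small t ^ (n + 1) := by
  obtain ⟨W, hW0, hW, hWsum⟩ := A.exists_averaging hn hnq hlow
  obtain ⟨C₁, hC₁, T, hT, hfield⟩ := S.norm_field_sub_le hK (fun p hp => (hKU hp).1) n
  -- A single continuous function dominating every quantity to be estimated, so that one bound `M`
  -- on `K` serves for all.
  let Φ : ℝ × ℝ → ℝ := fun p => ∑ k ∈ Finset.range (n + 1), (|W k p| + ‖fderiv ℝ (W k) p‖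
    + ∑ i ∈ Finset.range (n + 1), |fderiv ℝ (W k) p (S.fieldCoeff i p)|)
  have hUo := S.isOpen_annulus E₀
  have hΦ : ContinuousOn Φ K := by
    refine continuousOn_finsetSum _ fun k hk => ?_
    have hWk := hW k (Nat.lt_succ_iff.1 (Finset.mem_range.1 hk))
    have hd : ContinuousOn (fderiv ℝ (W k)) K :=
      (hWk.continuousOn_fderiv_of_isOpen hUo (by simp)).mono hKU
    refine ((hWk.continuousOn.mono hKU).abs.add hd.norm).add
      (continuousOn_finsetSum _ fun i _ => ?_)
    exact (hd.clm_apply ((S.contDiffOn_fieldCoeff i).continuousOn.mono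
      fun p hp => (hKU hp).1)).abs
  obtain ⟨M, hM⟩ := hK.exists_bound_of_continuousOn hΦ
  refine ⟨fun t p => ∑ k ∈ Finset.range (n + 1), S.small t ^ k * W k p,
    -- The summands 1, C₁ and n pay for the truncated product (`e3`), the remainder of the field
    -- (`e2`) and the derivatives of t^{-k/q} (`e1`).
    (1 + C₁ + n) * |M|, by positivity, T, hT, fun t ht => ?_⟩
  have ht1 : 1 ≤ t := hT.le.trans ht
  have ht0 : 0 < t := by linarith
  have hs0 := (S.small_pos ht0).le
  have hs1 := S.small_le_one ht1
  set s := S.small t with hs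
  have hsplit : ∀ p ∈ K, ∑ k ∈ Finset.range (n + 1), |W k p| ≤ |M| ∧
      ∑ k ∈ Finset.range (n + 1), ‖fderiv ℝ (W k) p‖ ≤ |M| ∧
      ∑ k ∈ Finset.range (n + 1), ∑ i ∈ Finset.range (n + 1),
        |fderiv ℝ (W k) p (S.fieldCoeff i p)| ≤ |M| := fun p hp => by
    have h := ((le_abs_self _).trans (hM p hp)).trans (le_abs_self M)
    simp only [Φ, Finset.sum_add_distrib] at h
    have h1 : 0 ≤ ∑ k ∈ Finset.range (n + 1), |W k p| :=
      Finset.sum_nonneg fun _ _ => abs_nonneg _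
    have h2 : 0 ≤ ∑ k ∈ Finset.range (n + 1), ‖fderiv ℝ (W k) p‖ :=
      Finset.sum_nonneg fun _ _ => norm_nonneg _
    have h3 : 0 ≤ ∑ k ∈ Finset.range (n + 1), ∑ i ∈ Finset.range (n + 1),
        |fderiv ℝ (W k) p (S.fieldCoeff i p)| :=
      Finset.sum_nonneg fun _ _ => Finset.sum_nonneg fun _ _ => abs_nonneg _
    exact ⟨by linarith, by linarith, by linarith⟩
  have hnn : (0 : ℝ) ≤ n := Nat.cast_nonneg n
  constructor
  · intro p hp
    change |∑ k ∈ Finset.range (n + 1), s ^ k * W k p - S.H₀ p| ≤ _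
    rw [Finset.sum_range_succ', pow_zero, one_mul, hW0, add_sub_cancel_right]
    have h1 : |∑ k ∈ Finset.range n, s ^ (k + 1) * W (k + 1) p|
        ≤ s * ∑ k ∈ Finset.range (n + 1), |W k p| := by
      rw [Finset.sum_range_succ', mul_add, Finset.mul_sum]
      refine (Finset.abs_sum_le_sum_abs _ _).trans ((Finset.sum_le_sum fun k _ => ?_).trans
        (le_add_of_nonneg_right (mul_nonneg hs0 (abs_nonneg _))))
      rw [abs_mul, abs_of_nonneg (pow_nonneg hs0 _)]
      exact mul_le_mul_of_nonneg_right (pow_le_of_le_one hs0 hs1 (by omega)) (abs_nonneg _)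
    have h2 := mul_le_mul_of_nonneg_left (hsplit p hp).1 hs0
    have h3 : 0 ≤ (C₁ + n) * (|M| * s) := by positivity
    linarith
  · intro z Γ hz hder
    obtain ⟨b1, b2, b3⟩ := hsplit _ hz
    have hterm : ∀ k ∈ Finset.range (n + 1), HasDerivWithinAt (fun r => S.small r ^ k * W k (z r))
        (-(k / S.q) * s ^ k * t⁻¹ * W k (z t)
          + s ^ k * fderiv ℝ (W k) (z t) (S.field t (z t))) Γ t := fun k hk => by
      have hWk := ((hW k (Nat.lt_succ_iff.1 (Finset.mem_range.1 hk))).contDiffAt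
        (hUo.mem_nhds (hKU hz))).differentiableAt (by simp)
      exact (S.hasDerivAt_small_pow ht0 k).hasDerivWithinAt.mul
        (hWk.hasFDerivAt.comp_hasDerivWithinAt t hder)
    refine ⟨_, HasDerivWithinAt.fun_sum hterm, ?_⟩
    set R := S.field t (z t) - ∑ i ∈ Finset.range (n + 1), s ^ i • S.fieldCoeff i (z t) with hR
    have hRle : ‖R‖ ≤ C₁ * s ^ (n + 1) := hfield t ht _ hz
    have hf : S.field t (z t) = ∑ i ∈ Finset.range (n + 1), s ^ i • S.fieldCoeff i (z t) + R := by
      rw [hR]; abel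
    have hmain := abs_sum_mul_sub_le
      (a := fun k i => fderiv ℝ (W k) (z t) (S.fieldCoeff i (z t))) hs0 hs1 (hWsum _ (hKU hz))
    have e1 : |∑ k ∈ Finset.range (n + 1), -(k / S.q) * s ^ k * t⁻¹ * W k (z t)|
        ≤ n * |M| * s ^ (n + 1) := by
      have : ∀ k ∈ Finset.range (n + 1), |-((k : ℝ) / S.q) * s ^ k * t⁻¹ * W k (z t)|
          ≤ n * s ^ (n + 1) * |W k (z t)| := fun k hk => by
        have hkn : (k : ℝ) ≤ n := Nat.cast_le.2 (Nat.lt_succ_iff.1 (Finset.mem_range.1 hk))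
        have hq1 : (1 : ℝ) ≤ S.q := Nat.one_le_cast.2 S.q_pos
        rw [abs_mul]
        refine mul_le_mul_of_nonneg_right ?_ (abs_nonneg _)
        -- Since 1/t = s^q, the term has order k + q ≥ n + 1 when k ≥ 1; for k = 0 the factor k
        -- removes it.
        rw [← S.small_pow_q ht0, ← hs, neg_mul, neg_mul, abs_neg, mul_assoc, ← pow_add,
          abs_of_nonneg (by positivity)]
        rcases Nat.eq_zero_or_pos k with rfl | hk0
        · simp only [CharP.cast_eq_zero, zero_div, zero_mul]
          positivity
        · exact mul_le_mul ((div_le_self (Nat.cast_nonneg k) hq1).trans hkn)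
            (pow_le_pow_of_le_one hs0 hs1 (by omega)) (by positivity) hnn
      refine (Finset.abs_sum_le_sum_abs _ _).trans ((Finset.sum_le_sum this).trans ?_)
      rw [← Finset.mul_sum]
      calc _ ≤ n * s ^ (n + 1) * |M| := mul_le_mul_of_nonneg_left b1 (by positivity)
        _ = _ := by ring
    have e2 : |∑ k ∈ Finset.range (n + 1), s ^ k * fderiv ℝ (W k) (z t) R|
        ≤ C₁ * |M| * s ^ (n + 1) := by
      have : ∀ k ∈ Finset.range (n + 1), |s ^ k * fderiv ℝ (W k) (z t) R|
          ≤ C₁ * s ^ (n + 1) * ‖fderiv ℝ (W k) (z t)‖ := fun k _ => by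
        rw [abs_mul, abs_of_nonneg (pow_nonneg hs0 _)]
        have h1 : |fderiv ℝ (W k) (z t) R| ≤ C₁ * s ^ (n + 1) * ‖fderiv ℝ (W k) (z t)‖ :=
          ((fderiv ℝ (W k) (z t)).le_opNorm R).trans (by
            rw [mul_comm]
            exact mul_le_mul_of_nonneg_right hRle (norm_nonneg _))
        exact (mul_le_of_le_one_left (abs_nonneg _) (pow_le_one₀ hs0 hs1)).trans h1
      refine (Finset.abs_sum_le_sum_abs _ _).trans ((Finset.sum_le_sum this).trans ?_)
      rw [← Finset.mul_sum]
      calc _ ≤ C₁ * s ^ (n + 1) * |M| := mul_le_mul_of_nonneg_left b2 (by positivity)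
        _ = _ := by ring
    have e3 := hmain.trans (mul_le_mul_of_nonneg_left b3 (pow_nonneg hs0 (n + 1)))
    have hd : ∑ k ∈ Finset.range (n + 1), (-(k / S.q) * s ^ k * t⁻¹ * W k (z t)
          + s ^ k * fderiv ℝ (W k) (z t) (S.field t (z t))) - s ^ n * A.Lam n (S.H₀ (z t))
        = ∑ k ∈ Finset.range (n + 1), -(k / S.q) * s ^ k * t⁻¹ * W k (z t)
          + ∑ k ∈ Finset.range (n + 1), s ^ k * fderiv ℝ (W k) (z t) R
          + (∑ k ∈ Finset.range (n + 1), s ^ k * ∑ i ∈ Finset.range (n + 1),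
            s ^ i * fderiv ℝ (W k) (z t) (S.fieldCoeff i (z t))
              - s ^ n * A.Lam n (S.H₀ (z t))) := by
      rw [add_sub_assoc', add_assoc, ← Finset.sum_add_distrib, ← Finset.sum_add_distrib]
      congr 1
      refine Finset.sum_congr rfl fun k _ => ?_
      rw [hf, map_add, map_sum]
      simp only [map_smul, smul_eq_mul]
      ring
    rw [hd]
    refine (abs_add_three _ _ _).trans ?_
    linarith

end ActionAngle

/-! ### Differential inequalities and energy estimates. -/

/-- Comparison for the differential inequality `w' ≤ σ (κ - a w)`, where `σ = Θ'`. -/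
theorem sub_le_mul_exp_of_deriv_le {w σ Θ : ℝ → ℝ} {τ T a κ : ℝ} (ha : 0 < a)
    (hw : ContinuousOn w (Icc τ T)) (hΘ : ∀ t ∈ Icc τ T, HasDerivAt Θ (σ t) t)
    (hd : ∀ t ∈ Ioo τ T, ∃ d, HasDerivAt w d t ∧ d ≤ σ t * (-a * w t + κ))
    {t : ℝ} (ht : t ∈ Icc τ T) :
    w t - κ / a ≤ (w τ - κ / a) * Real.exp (-(a * (Θ t - Θ τ))) := by
  -- The integrating factor exp(aΘ) makes (w - κ/a) exp(aΘ) nonincreasing.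
  have hder : ∀ t ∈ Ioo τ T, ∃ d ≤ 0,
      HasDerivAt (fun t => (w t - κ / a) * Real.exp (a * Θ t)) d t := fun t ht => by
    obtain ⟨d, hd1, hd2⟩ := hd t ht
    refine ⟨_, ?_, (hd1.sub_const (κ / a)).mul ((hΘ t (Ioo_subset_Icc_self ht)).const_mul a).exp⟩
    have h1 : d * Real.exp (a * Θ t) + (w t - κ / a) * (Real.exp (a * Θ t) * (a * σ t))
        = (d - σ t * (-a * w t + κ)) * Real.exp (a * Θ t) := by
      field_simp
      ring
    rw [h1]
    exact mul_nonpos_of_nonpos_of_nonneg (by linarith) (Real.exp_pos _).le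
  have hanti : AntitoneOn (fun t => (w t - κ / a) * Real.exp (a * Θ t)) (Icc τ T) := by
    refine antitoneOn_of_deriv_nonpos (convex_Icc τ T) ?_ ?_ ?_
    · have : ContinuousOn Θ (Icc τ T) := fun t ht => (hΘ t ht).continuousAt.continuousWithinAt
      fun_prop
    · intro t ht
      rw [interior_Icc] at ht
      obtain ⟨d, -, h⟩ := hder t ht
      exact h.differentiableAt.differentiableWithinAt
    · intro t ht
      rw [interior_Icc] at ht
      obtain ⟨d, h0, h⟩ := hder t ht
      rwa [h.deriv]
  have h := hanti (left_mem_Icc.2 (ht.1.trans ht.2)) ht ht.1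
  simp only at h
  rw [show -(a * (Θ t - Θ τ)) = a * Θ τ - a * Θ t by ring, Real.exp_sub, ← mul_div_assoc,
    le_div_iff₀ (Real.exp_pos _)]
  exact h

namespace System

variable (S : System)

/-- Divergence of the integral of t^{-n/q}, logarithmic for n = q, is what turns weak damping into
convergence. -/
theorem exists_primitive_small_pow {n : ℕ} (hnq : n ≤ S.q) :
    ∃ Θ : ℝ → ℝ, (∀ t > 0, HasDerivAt Θ (S.small t ^ n) t) ∧ Tendsto Θ atTop atTop := by
  rcases hnq.eq_or_lt with rfl | hlt
  · refine ⟨Real.log, fun t ht => ?_, Real.tendsto_log_atTop⟩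
    rw [S.small_pow_q ht]
    exact Real.hasDerivAt_log ht.ne'
  · have hq : (0 : ℝ) < S.q := Nat.cast_pos.2 S.q_pos
    have hr : 0 < 1 - (n : ℝ) / S.q := by
      rw [sub_pos, div_lt_one hq]
      exact Nat.cast_lt.2 hlt
    refine ⟨fun t => t ^ (1 - (n : ℝ) / S.q) / (1 - (n : ℝ) / S.q), fun t ht => ?_,
      (tendsto_rpow_atTop hr).atTop_div_const hr⟩
    have h := (Real.hasDerivAt_rpow_const (p := 1 - (n : ℝ) / S.q) (Or.inl ht.ne')).div_const
      (1 - (n : ℝ) / S.q)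
    refine h.congr_deriv ?_
    rw [small, rpow_neg_one_div_pow ht.le, mul_div_cancel_left₀ _ hr.ne']
    congr 1
    ring

/-- The points of the phase domain with energy within `δ` of `c`. -/
def band (c δ : ℝ) : Set (ℝ × ℝ) := {p | p ∈ S.D ∧ |S.H₀ p - c| ≤ δ}

theorem band_subset_annulus {c δ E₀ : ℝ} (h : Icc (c - δ) (c + δ) ⊆ Ioo 0 E₀) :
    S.band c δ ⊆ S.annulus E₀ := fun p hp => ⟨hp.1, h (by
  have := abs_le.1 hp.2
  constructor <;> linarith)⟩

theorem band_subset_band {c δ δ' : ℝ} (h : δ ≤ δ') : S.band c δ ⊆ S.band c δ' :=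
  fun _ hp => ⟨hp.1, hp.2.trans h⟩

end System

namespace ActionAngle

variable {S : System} {E₀ : ℝ} (A : ActionAngle S E₀)

theorem exists_mem_Icc_chart_eq {p : ℝ × ℝ} (hp : p ∈ S.annulus E₀) :
    ∃ φ ∈ Icc 0 (2 * Real.pi), A.chart (S.H₀ p, φ) = p := by
  obtain ⟨φ, hφ⟩ := A.exists_chart_eq hp
  obtain ⟨θ, hθ, h1, -⟩ := exists_mem_Ico_of_periodic Real.two_pi_pos (A.periodic _ hp.2)
    (A.periodic _ hp.2) φ
  exact ⟨θ, Ico_subset_Icc_self hθ, h1.trans hφ⟩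

/-- The band is the chart image of a compact rectangle; this replaces properness of H₀, which is not
assumed. -/
theorem isCompact_band (A : ActionAngle S E₀) {c δ : ℝ} (h : Icc (c - δ) (c + δ) ⊆ Ioo 0 E₀) :
    IsCompact (S.band c δ) := by
  have h1 : IsCompact (A.chart '' (Icc (c - δ) (c + δ) ×ˢ Icc 0 (2 * Real.pi))) :=
    (isCompact_Icc.prod isCompact_Icc).image_of_continuousOn
      (A.contDiffOn_chart.continuousOn.mono (prod_mono h (subset_univ _)))
  convert h1
  ext p
  constructor
  · intro hp
    obtain ⟨φ, hφ, hφp⟩ := A.exists_mem_Icc_chart_eq (S.band_subset_annulus h hp)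
    have := abs_le.1 hp.2
    exact ⟨(S.H₀ p, φ), ⟨⟨by linarith, by linarith⟩, hφ⟩, hφp⟩
  · rintro ⟨⟨E, φ⟩, ⟨hE, -⟩, rfl⟩
    obtain ⟨h2, h3⟩ := A.chart_mem_levelCurve (h hE) φ
    refine ⟨h2, ?_⟩
    rw [h3, abs_le]
    simp only [mem_Icc] at hE
    constructor <;> linarith [hE.1, hE.2]

/-- The dissipation inequality for the squared deviation of the corrected energy. -/
theorem exists_dissipation {n : ℕ} (hn : 1 ≤ n) (hnq : n ≤ S.q)
    (hlow : ∀ k, 1 ≤ k → k < n → ∀ E ∈ Ioo 0 E₀, A.Lam k E = 0) {c δ a : ℝ} (hδ : 0 < δ)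
    (ha : 0 < a) (hcδ : Icc (c - δ) (c + δ) ⊆ Ioo 0 E₀)
    (hΛ : ∀ E, |E - c| ≤ δ → |A.Lam n E + 2 * a * (E - c)| ≤ a * |E - c|) :
    ∃ y : ℝ → ℝ × ℝ → ℝ, ∃ C ≥ 0, ∃ T ≥ 1, ∀ t ≥ T,
      (∀ p ∈ S.band c δ, |y t p - (S.H₀ p - c)| ≤ C * S.small t) ∧
      ∀ (z : ℝ → ℝ × ℝ) (Γ : Set ℝ), z t ∈ S.band c δ →
        HasDerivWithinAt z (S.field t (z t)) Γ t →
        ∃ d, HasDerivWithinAt (fun r => y r (z r) ^ 2) d Γ t ∧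
          d ≤ S.small t ^ n * (-a * y t (z t) ^ 2 + C * S.small t) := by
  obtain ⟨u, C, hC, T, hT, hu⟩ := A.exists_lyapunov hn hnq hlow (A.isCompact_band hcδ)
    (S.band_subset_annulus hcδ)
  -- With e = H₀ - c, the three terms in parentheses come from y² ≤ 2e² + 2C²s, from replacing e by
  -- y in e·Λ_n, and from the error in u' times |y| ≤ δ + C. The factor 2 is that of (y²)' = 2yy'.
  refine ⟨fun t p => u t p - c, C + 2 * (a * C ^ 2 + 3 * a * δ * C + (δ + C) * C), by positivity,
    T, hT, fun t ht => ?_⟩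
  have ht1 : 1 ≤ t := hT.le.trans ht
  have ht0 : 0 < t := by linarith
  have hs0 := S.small_pos ht0
  have hs1 := S.small_le_one ht1
  obtain ⟨hu1, hu2⟩ := hu t ht
  set s := S.small t with hs
  constructor
  · intro p hp
    have h1 := hu1 p hp
    rw [sub_sub_sub_cancel_right]
    have h2 : 0 ≤ 2 * (a * C ^ 2 + 3 * a * δ * C + (δ + C) * C) * s := by positivity
    linarith
  · intro z Γ hz hd
    obtain ⟨d, hd1, hd2⟩ := hu2 z Γ hz hd
    have h1 := hu1 _ hz
    have he := hz.2
    have hL := hΛ _ he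
    refine ⟨_, (hd1.sub_const c).fun_pow 2, ?_⟩
    set L := A.Lam n (S.H₀ (z t))
    set e := S.H₀ (z t) - c with he_def
    set U := u t (z t)
    have hUe : |U - c - e| ≤ C * s := by
      rw [he_def, sub_sub_sub_cancel_right]
      exact h1
    set y := U - c
    have hC2 : 0 ≤ C * s := by positivity
    have hCs : C * s ≤ C := mul_le_of_le_one_right hC hs1
    have hy : |y| ≤ δ + C := by
      have : y = e + (y - e) := by ring
      rw [this]
      exact (abs_add_le _ _).trans (by linarith)
    have hLabs : |L| ≤ 3 * a * δ := by
      have h2 : L = (L + 2 * a * e) - 2 * a * e := by ring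
      rw [h2]
      refine (abs_sub _ _).trans ?_
      rw [abs_mul, abs_of_pos (by positivity : 0 < 2 * a)]
      have := mul_le_mul_of_nonneg_left he ha.le
      linarith
    have heL : e * L ≤ -a * e ^ 2 := by
      have h2 : e * (L + 2 * a * e) ≤ |e| * (a * |e|) := by
        refine (le_abs_self _).trans ?_
        rw [abs_mul]
        exact mul_le_mul_of_nonneg_left hL (abs_nonneg _)
      have h3 : |e| * |e| = e ^ 2 := by rw [← sq, sq_abs]
      have h4 : |e| * (a * |e|) = a * e ^ 2 := by rw [← h3]; ring
      linarith
    have hyL : y * L ≤ -a * e ^ 2 + 3 * a * δ * C * s := by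
      have h2 : (y - e) * L ≤ C * s * (3 * a * δ) := by
        refine (le_abs_self _).trans ?_
        rw [abs_mul]
        exact mul_le_mul hUe hLabs (abs_nonneg _) hC2
      linarith
    have hyd : y * (d - s ^ n * L) ≤ s ^ n * ((δ + C) * C * s) := by
      refine (le_abs_self _).trans ?_
      rw [abs_mul]
      refine (mul_le_mul hy hd2 (abs_nonneg _) (by positivity)).trans (le_of_eq ?_)
      ring
    have hy2 : y ^ 2 ≤ 2 * e ^ 2 + 2 * C ^ 2 * s := by
      have h2 : (y - e) ^ 2 ≤ (C * s) ^ 2 := sq_le_sq' (abs_le.1 hUe).1 (abs_le.1 hUe).2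
      have h3 : (C * s) ^ 2 ≤ C ^ 2 * s := by
        rw [mul_pow]
        exact mul_le_mul_of_nonneg_left (by nlinarith) (by positivity)
      nlinarith [sq_nonneg (y - 2 * e)]
    have hsn : 0 ≤ s ^ n := by positivity
    have h5 : y * d = s ^ n * (y * L) + y * (d - s ^ n * L) := by ring
    have h6 := mul_le_mul_of_nonneg_left hyL hsn
    have h7 : s ^ n * (a * y ^ 2) ≤ s ^ n * (a * (2 * e ^ 2 + 2 * C ^ 2 * s)) :=
      mul_le_mul_of_nonneg_left (mul_le_mul_of_nonneg_left hy2 ha.le) hsn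
    have h8 : 0 ≤ s ^ n * (C * s) := by positivity
    have h9 : ((2 : ℕ) : ℝ) * y ^ (2 - 1) * d = 2 * (y * d) := by norm_num; ring
    rw [h9, h5]
    linarith

end ActionAngle

namespace ActionAngle

variable {S : System} {E₀ : ℝ} (A : ActionAngle S E₀)

/-- Solutions which stay in a band around a stable zero of `Λ_n`: their energy stays near the zero
if it is near it at a late time, and it tends to the zero. -/
theorem exists_energy_estimates {n : ℕ} (hn : 1 ≤ n) (hnq : n ≤ S.q)
    (hlow : ∀ k, 1 ≤ k → k < n → ∀ E ∈ Ioo 0 E₀, A.Lam k E = 0) {c δ a : ℝ} (hδ : 0 < δ)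
    (ha : 0 < a) (hcδ : Icc (c - δ) (c + δ) ⊆ Ioo 0 E₀)
    (hΛ : ∀ E, |E - c| ≤ δ → |A.Lam n E + 2 * a * (E - c)| ≤ a * |E - c|) :
    (∀ η > 0, ∃ T ≥ 1, ∀ τ ≥ T, ∀ t ≥ τ, ∀ z : ℝ → ℝ × ℝ,
      (∀ r ∈ Icc τ t, z r ∈ S.band c δ ∧ HasDerivWithinAt z (S.field r (z r)) (Ici τ) r) →
      |S.H₀ (z τ) - c| ≤ η / 4 → |S.H₀ (z t) - c| < η) ∧
    (∀ τ > 0, ∀ z : ℝ → ℝ × ℝ,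
      (∀ r ≥ τ, z r ∈ S.band c δ ∧ HasDerivWithinAt z (S.field r (z r)) (Ici τ) r) →
      Tendsto (fun t => S.H₀ (z t)) atTop (𝓝 c)) := by
  obtain ⟨y, C, hC, T, hT, hy⟩ := A.exists_dissipation hn hnq hlow hδ ha hcδ hΛ
  obtain ⟨Θ, hΘ, hΘtop⟩ := S.exists_primitive_small_pow hnq
  -- The solution starts at `τ₀`, the estimate at a possibly later `τ`. On [τ, t] the forcing is at
  -- most C·small(τ), so a late restart makes it as small as desired.
  have key : ∀ τ₀, ∀ τ ≥ T, τ₀ ≤ τ → ∀ t ≥ τ, ∀ z : ℝ → ℝ × ℝ,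
      (∀ r ∈ Icc τ t, z r ∈ S.band c δ ∧ HasDerivWithinAt z (S.field r (z r)) (Ici τ₀) r) →
      y t (z t) ^ 2 - C * S.small τ / a
        ≤ (y τ (z τ) ^ 2 - C * S.small τ / a) * Real.exp (-(a * (Θ t - Θ τ))) := by
    intro τ₀ τ hτ hτ₀ t ht z hz
    have hpos : ∀ r ≥ τ, 0 < r := fun r hr => by linarith
    refine sub_le_mul_exp_of_deriv_le (w := fun r => y r (z r) ^ 2) (σ := fun r => S.small r ^ n)
      ha ?_ (fun r hr => hΘ r (hpos r hr.1)) ?_ (right_mem_Icc.2 ht)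
    · intro r hr
      obtain ⟨d, hd, -⟩ := (hy r (hτ.trans hr.1)).2 z _ (hz r hr).1 (hz r hr).2
      exact hd.continuousWithinAt.mono fun x hx => hτ₀.trans hx.1
    · intro r hr
      obtain ⟨hz1, hz2⟩ := hz r (Ioo_subset_Icc_self hr)
      obtain ⟨d, hd1, hd2⟩ := (hy r (hτ.trans hr.1.le)).2 z _ hz1 hz2
      refine ⟨d, hd1.hasDerivAt (Ici_mem_nhds (hτ₀.trans_lt hr.1)), hd2.trans ?_⟩
      have hsr := S.antitoneOn_small (hpos τ le_rfl) (hpos r hr.1.le) hr.1.le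
      have h0 := S.small_pos (hpos r hr.1.le)
      gcongr
  have hsmall : ∀ κ > 0, ∃ T' ≥ T, ∀ t ≥ T', C * S.small t ≤ κ := fun κ hκ => by
    have h1 : Tendsto (fun t => C * S.small t) atTop (𝓝 0) := by
      simpa using S.tendsto_small.const_mul C
    obtain ⟨T', hT'⟩ := eventually_atTop.1 (h1.eventually (ge_mem_nhds hκ))
    exact ⟨max T T', le_max_left _ _, fun t ht => hT' t (le_trans (le_max_right _ _) ht)⟩
  constructor
  · intro η hη
    -- Initially |y| ≤ η/4 + η/8 = 3η/8; the forcing adds at most η²/16 to y², and 9/64 + 4/64 <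
    -- 1/4. Thus |y| < η/2 and |H₀ - c| < η/2 + η/8.
    obtain ⟨T', hT', hsm⟩ := hsmall (min (η / 8) (a * (η ^ 2 / 16))) (by positivity)
    refine ⟨T', hT.le.trans hT', fun τ hτ t ht z hz hzτ => ?_⟩
    have hτT := hT'.le.trans hτ
    have h1 := key τ τ hτT le_rfl t ht z hz
    have hκ : C * S.small τ / a ≤ η ^ 2 / 16 := by
      rw [div_le_iff₀ ha, mul_comm _ a]
      exact (hsm τ hτ).trans (min_le_right _ _)
    have hsmall0 : 0 ≤ C * S.small τ / a :=
      div_nonneg (mul_nonneg hC (S.small_pos (by linarith)).le) ha.le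
    have hyτ : |y τ (z τ)| ≤ 3 * η / 8 := by
      have h2 := (hy τ hτT).1 _ (hz τ (left_mem_Icc.2 ht)).1
      have h3 := (hsm τ hτ).trans (min_le_left _ _)
      have h4 : y τ (z τ) = (y τ (z τ) - (S.H₀ (z τ) - c)) + (S.H₀ (z τ) - c) := by ring
      rw [h4]
      exact (abs_add_le _ _).trans (by linarith)
    have hexp1 : Real.exp (-(a * (Θ t - Θ τ))) ≤ 1 := by
      have hmono : Θ τ ≤ Θ t := by
        have hpos : ∀ r ≥ τ, 0 < r := fun r hr => by linarith
        refine monotoneOn_of_deriv_nonneg (convex_Ici τ)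
          (fun r hr => (hΘ r (hpos r hr)).continuousAt.continuousWithinAt) ?_ ?_
          self_mem_Ici ht ht
        · intro r hr
          rw [interior_Ici] at hr
          exact (hΘ r (hpos r (le_of_lt hr))).differentiableAt.differentiableWithinAt
        · intro r hr
          rw [interior_Ici] at hr
          rw [(hΘ r (hpos r (le_of_lt hr))).deriv]
          exact pow_nonneg (S.small_pos (hpos r (le_of_lt hr))).le _
      rw [Real.exp_le_one_iff, neg_nonpos]
      exact mul_nonneg ha.le (sub_nonneg.2 hmono)
    have hyt : y t (z t) ^ 2 < (η / 2) ^ 2 := by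
      have h5 : y τ (z τ) ^ 2 ≤ (3 * η / 8) ^ 2 := sq_le_sq' (abs_le.1 hyτ).1 (abs_le.1 hyτ).2
      have h6 : (y τ (z τ) ^ 2 - C * S.small τ / a) * Real.exp (-(a * (Θ t - Θ τ)))
          ≤ y τ (z τ) ^ 2 := by
        refine (mul_le_mul_of_nonneg_right (sub_le_self _ hsmall0) (Real.exp_pos _).le).trans ?_
        exact mul_le_of_le_one_right (sq_nonneg _) hexp1
      nlinarith [sq_pos_of_pos hη]
    have hyt' := abs_lt_of_sq_lt_sq hyt (by positivity)
    have h7 := (hy t (hτT.trans ht)).1 _ (hz t (right_mem_Icc.2 ht)).1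
    have h8 := (hsm t (le_trans hτ ht)).trans (min_le_left _ _)
    have h9 : S.H₀ (z t) - c = y t (z t) - (y t (z t) - (S.H₀ (z t) - c)) := by ring
    rw [h9]
    exact (abs_sub _ _).trans_lt (by linarith)
  · intro τ₀ hτ₀ z hz
    rw [Metric.tendsto_atTop]
    intro η hη
    obtain ⟨T', hT', hsm⟩ := hsmall (min (η / 4) (a * (η ^ 2 / 16))) (by positivity)
    set τ := max τ₀ T'
    have hττ₀ : τ₀ ≤ τ := le_max_left _ _
    have hτT' : T' ≤ τ := le_max_right _ _
    have hκ : C * S.small τ / a ≤ η ^ 2 / 16 := by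
      rw [div_le_iff₀ ha, mul_comm _ a]
      exact (hsm τ hτT').trans (min_le_right _ _)
    have hexp : Tendsto (fun t => (y τ (z τ) ^ 2 - C * S.small τ / a) *
        Real.exp (-(a * (Θ t - Θ τ)))) atTop (𝓝 0) := by
      have h1 : Tendsto (fun t => a * (Θ t - Θ τ)) atTop atTop :=
        (tendsto_atTop_add_const_right _ (-Θ τ) hΘtop).const_mul_atTop ha
      simpa using (Real.tendsto_exp_neg_atTop_nhds_zero.comp h1).const_mul
        (y τ (z τ) ^ 2 - C * S.small τ / a)
    obtain ⟨T'', hT''⟩ := eventually_atTop.1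
      (hexp.eventually (gt_mem_nhds (by positivity : 0 < η ^ 2 / 16)))
    refine ⟨max τ T'', fun t ht => ?_⟩
    have htτ : τ ≤ t := (le_max_left _ _).trans ht
    have h1 := key τ₀ τ (hT'.le.trans hτT') hττ₀ t htτ z fun r hr => hz r (hττ₀.trans hr.1)
    have h2 := hT'' t ((le_max_right _ _).trans ht)
    have hyt : y t (z t) ^ 2 < (η / 2) ^ 2 := by nlinarith
    have hyt' := abs_lt_of_sq_lt_sq hyt (by positivity)
    have h7 := (hy t (hT'.le.trans (hτT'.trans htτ))).1 _ (hz t (hττ₀.trans htτ)).1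
    have h8 := (hsm t (hτT'.trans htτ)).trans (min_le_left _ _)
    have h9 : S.H₀ (z t) - c = y t (z t) - (y t (z t) - (S.H₀ (z t) - c)) := by ring
    rw [Real.dist_eq, h9]
    exact (abs_sub _ _).trans_lt (by linarith)

/-- Curves which solve the system as long as they are in a band around a stable zero of `Λ_n` stay
in smaller bands, if they start close to the zero at a late time. -/
theorem exists_confinement {n : ℕ} (hn : 1 ≤ n) (hnq : n ≤ S.q)
    (hlow : ∀ k, 1 ≤ k → k < n → ∀ E ∈ Ioo 0 E₀, A.Lam k E = 0) {c δ a : ℝ} (hδ : 0 < δ)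
    (ha : 0 < a) (hcδ : Icc (c - δ) (c + δ) ⊆ Ioo 0 E₀)
    (hΛ : ∀ E, |E - c| ≤ δ → |A.Lam n E + 2 * a * (E - c)| ≤ a * |E - c|)
    {η : ℝ} (hη : 0 < η) (hηδ : η ≤ δ) :
    ∃ T ≥ 1, ∀ τ ≥ T, ∀ z : ℝ → ℝ × ℝ, ContinuousOn z (Ici τ) →
      (∀ r ≥ τ, z r ∈ S.band c δ → HasDerivWithinAt z (S.field r (z r)) (Ici τ) r) →
      z τ ∈ S.D → |S.H₀ (z τ) - c| ≤ η / 4 → ∀ t ≥ τ, z t ∈ S.D ∧ |S.H₀ (z t) - c| < η := by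
  obtain ⟨T, hT, hest⟩ := (A.exists_energy_estimates hn hnq hlow hδ ha hcδ hΛ).1 η hη
  refine ⟨T, hT, fun τ hτ z hzc hzd hzD hzτ => ?_⟩
  set O : Set (ℝ × ℝ) := {p | p ∈ S.D ∧ |S.H₀ p - c| < η} with hO_def
  have hO : IsOpen O := S.smooth_H₀.continuousOn.isOpen_inter_preimage S.isOpen_D
    (t := Metric.ball c η) Metric.isOpen_ball
  by_contra! hcon
  -- `B` is closed, so the first exit time is attained; the energy estimate on the interval up to it
  -- then contradicts the exit.
  set B : Set ℝ := Ici τ ∩ z ⁻¹' Oᶜ with hB_def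
  have hBc : IsClosed B := hzc.preimage_isClosed_of_isClosed isClosed_Ici hO.isClosed_compl
  have hBne : B.Nonempty := by
    obtain ⟨t, ht, h⟩ := hcon
    exact ⟨t, ht, fun h' => absurd h'.2 (not_lt.2 (h h'.1))⟩
  have hBbdd : BddBelow B := ⟨τ, fun t ht => ht.1⟩
  have hmem : sInf B ∈ B := hBc.csInf_mem hBne hBbdd
  set t := sInf B
  have hτO : z τ ∈ O := ⟨hzD, by linarith⟩
  have hτt : τ < t := lt_of_le_of_ne hmem.1 fun h => hmem.2 (h ▸ hτO)
  have hin : ∀ r ∈ Ico τ t, z r ∈ O := fun r hr => by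
    by_contra h
    exact absurd (csInf_le hBbdd (show r ∈ B from ⟨hr.1, h⟩)) (not_le.2 hr.2)
  have hsub : O ⊆ S.band c η := fun p hp => ⟨hp.1, hp.2.le⟩
  have hηc : Icc (c - η) (c + η) ⊆ Ioo 0 E₀ :=
    (Icc_subset_Icc (by linarith) (by linarith)).trans hcδ
  -- Compactness of the band excludes an exit through the boundary of `D`.
  have hclosed : closure O ⊆ S.band c η :=
    closure_minimal hsub (A.isCompact_band hηc).isClosed
  have htb : z t ∈ S.band c η := by
    refine hclosed (ContinuousWithinAt.mem_closure (s := Ico τ t)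
      ((hzc t hmem.1).mono fun r hr => hr.1) ?_ hin)
    rw [closure_Ico hτt.ne]
    exact right_mem_Icc.2 hτt.le
  have hband : ∀ r ∈ Icc τ t, z r ∈ S.band c δ := fun r hr => S.band_subset_band hηδ (by
    rcases hr.2.eq_or_lt with rfl | h
    · exact htb
    · exact hsub (hin r ⟨hr.1, h⟩))
  have := hest τ hτ t hτt.le z (fun r hr => ⟨hband r hr, hzd r hr.1 (hband r hr)⟩) hzτ
  exact hmem.2 ⟨htb.1, this⟩

end ActionAngle

/-! ### Global existence by cutoff. -/

section ODE

variable {E : Type*} [NormedAddCommGroup E] [NormedSpace ℝ E]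

/-- Global existence for bounded Lipschitz vector fields. -/
theorem exists_global_solution [CompleteSpace E] {v : ℝ → E → E} {τ : ℝ}
    (hcont : ∀ x, ContinuousOn (fun t => v t x) (Ici τ))
    (hlip : ∀ T, ∃ K L : NNReal, ∀ t ∈ Icc τ T, LipschitzWith K (v t) ∧ ∀ x, ‖v t x‖ ≤ L)
    (x₀ : E) :
    ∃ z : ℝ → E, z τ = x₀ ∧ ∀ t ≥ τ, HasDerivWithinAt z (v t (z t)) (Ici τ) t := by
  have hloc : ∀ N : ℕ, ∃ z : ℝ → E, z τ = x₀ ∧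
      ∀ t ∈ Icc τ (τ + N), HasDerivWithinAt z (v t (z t)) (Icc τ (τ + N)) t := fun N => by
    obtain ⟨K, L, h⟩ := hlip (τ + N)
    have hN : (0 : ℝ) ≤ N := Nat.cast_nonneg N
    -- The bound `L` holds everywhere, so a ball of radius L·N accommodates a time span of length N.
    have hpl : IsPicardLindelof v (tmin := τ) (tmax := τ + N) ⟨τ, left_mem_Icc.2 (by linarith)⟩ x₀
        (L * N) 0 L K :=
      { lipschitzOnWith := fun t ht => (h t ht).1.lipschitzOnWith
        continuousOn := fun x _ => (hcont x).mono Icc_subset_Ici_self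
        norm_le := fun t ht x _ => (h t ht).2 x
        mul_max_le := by simp }
    exact hpl.exists_eq_forall_mem_Icc_hasDerivWithinAt₀
  choose Z hZ0 hZ using hloc
  have hright : ∀ N : ℕ, ∀ t ∈ Ico τ (τ + N), HasDerivWithinAt (Z N) (v t (Z N t)) (Ici t) t :=
    fun N t ht => (hZ N t (Ico_subset_Icc_self ht)).mono_of_mem_nhdsWithin
      (mem_of_superset (Icc_mem_nhdsGE ht.2) (Icc_subset_Icc_left ht.1))
  have huniq : ∀ M N : ℕ, M ≤ N → EqOn (Z M) (Z N) (Icc τ (τ + M)) := fun M N hMN => by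
    obtain ⟨K, L, h⟩ := hlip (τ + M)
    have hle : τ + (M : ℝ) ≤ τ + N := by
      have : (M : ℝ) ≤ N := Nat.cast_le.2 hMN
      linarith
    refine ODE_solution_unique_of_mem_Icc_right (v := v) (s := fun _ => univ)
      (fun t ht => (h t (Ico_subset_Icc_self ht)).1.lipschitzOnWith)
      (fun t ht => (hZ M t ht).continuousWithinAt) (hright M) (fun _ _ => mem_univ _)
      (fun t ht => ?_) (fun t ht => hright N t ⟨ht.1, ht.2.trans_le hle⟩) (fun _ _ => mem_univ _)
      ((hZ0 M).trans (hZ0 N).symm)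
    exact (hZ N t ⟨ht.1, ht.2.trans hle⟩).continuousWithinAt.mono (Icc_subset_Icc_right hle)
  -- By uniqueness the solutions on [τ, τ + N] agree, and any N ≥ t - τ gives the same value at t.
  let z : ℝ → E := fun t => Z (⌈t - τ⌉₊) t
  have hzN : ∀ N : ℕ, EqOn z (Z N) (Icc τ (τ + N)) := fun N t ht => by
    have h1 : t - τ ≤ ⌈t - τ⌉₊ := Nat.le_ceil _
    have h2 : ⌈t - τ⌉₊ ≤ N := Nat.ceil_le.2 (by linarith [ht.2])
    exact huniq _ N h2 ⟨ht.1, by linarith⟩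
  refine ⟨z, by rw [hzN 0 ⟨le_rfl, by simp⟩, hZ0], fun t ht => ?_⟩
  obtain ⟨N, hN⟩ := exists_nat_gt (t - τ)
  have htN : t ∈ Icc τ (τ + N) := ⟨ht, by linarith⟩
  have h1 := (hZ N t htN).congr (hzN N) (hzN N htN)
  rw [← hzN N htN] at h1
  refine h1.mono_of_mem_nhdsWithin ?_
  exact mem_of_superset (inter_mem_nhdsWithin _ (Iic_mem_nhds (show t < τ + N by linarith)))
    fun x hx => ⟨hx.1, hx.2⟩

theorem exists_contDiff_cutoff [FiniteDimensional ℝ E] {K D : Set E} (hK : IsCompact K)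
    (hD : IsOpen D) (hKD : K ⊆ D) :
    ∃ χ : E → ℝ, ContDiff ℝ ∞ χ ∧ IsCompact (tsupport χ) ∧ tsupport χ ⊆ D ∧ ∀ x ∈ K, χ x = 1 := by
  obtain ⟨L, hL, hKL, hLD⟩ := exists_compact_between hK hD hKD
  obtain ⟨χ, h0, h1, -⟩ := exists_contMDiffMap_zero_one_of_isClosed (n := ⊤)
    (modelWithCornersSelf ℝ E) (isOpen_interior (s := L)).isClosed_compl hK.isClosed
    (disjoint_left.2 fun x hx hxK => hx (hKL hxK))
  have hsupp : tsupport χ ⊆ L := closure_minimal (fun x hx => by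
    by_contra hxL
    exact hx (h0 fun h => hxL (interior_subset h))) hL.isClosed
  exact ⟨χ, χ.contMDiff.contDiff, hL.of_isClosed_subset (isClosed_tsupport _) hsupp,
    hsupp.trans hLD, h1⟩

/-- A smooth time-dependent field multiplied by a cutoff function is bounded and Lipschitz. -/
theorem lipschitzWith_cutoff {F : Type*} [NormedAddCommGroup F] [NormedSpace ℝ F]
    {D : Set E} (hD : IsOpen D) {χ : E → ℝ} (hχ : ContDiff ℝ ∞ χ)
    (hχc : IsCompact (tsupport χ)) (hχD : tsupport χ ⊆ D) {G : E × ℝ → F}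
    (hG : ContDiffOn ℝ ∞ G (D ×ˢ Ioi 0)) {τ : ℝ} (hτ : 0 < τ) :
    (∀ x, ContinuousOn (fun t => χ x • G (x, t)) (Ici τ)) ∧
    ∀ T, ∃ K L : NNReal, ∀ t ∈ Icc τ T, LipschitzWith K (fun x => χ x • G (x, t)) ∧
      ∀ x, ‖χ x • G (x, t)‖ ≤ L := by
  have hO : IsOpen (D ×ˢ Ioi (0 : ℝ)) := hD.prod isOpen_Ioi
  have hzero : ∀ x ∉ tsupport χ, χ x = 0 := fun x hx => image_eq_zero_of_notMem_tsupport hx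
  constructor
  · intro x
    by_cases hx : x ∈ tsupport χ
    · exact continuousOn_const.smul (hG.continuousOn.comp (f := fun t : ℝ => (x, t)) (by fun_prop)
        fun t ht => ⟨hχD hx, hτ.trans_le ht⟩)
    · simp only [hzero x hx, zero_smul]
      exact continuousOn_const
  · intro T
    set J : E × ℝ → F := fun a => χ a.1 • G a with hJ
    have hJs : ContDiffOn ℝ ∞ J (D ×ˢ Ioi 0) := (hχ.comp contDiff_fst).contDiffOn.smul hG
    have hsub : tsupport χ ×ˢ Icc τ T ⊆ D ×ˢ Ioi 0 := fun a ha =>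
      ⟨hχD ha.1, hτ.trans_le ha.2.1⟩
    obtain ⟨L, hL⟩ := (hχc.prod (isCompact_Icc (a := τ) (b := T))).exists_bound_of_continuousOn
      (hJs.continuousOn.mono hsub)
    obtain ⟨C, hC⟩ := (hχc.prod (isCompact_Icc (a := τ) (b := T))).exists_bound_of_continuousOn
      ((hJs.continuousOn_fderiv_of_isOpen hO (by simp)).mono hsub)
    have hder : ∀ t ∈ Icc τ T, ∀ x, ∃ J' : E →L[ℝ] F, ‖J'‖ ≤ |C| ∧
        HasFDerivAt (fun x => χ x • G (x, t)) J' x := fun t ht x => by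
      by_cases hx : x ∈ tsupport χ
      · refine ⟨(fderiv ℝ J (x, t)).comp (ContinuousLinearMap.inl ℝ E ℝ), ?_, ?_⟩
        · refine (ContinuousLinearMap.opNorm_comp_le _ _).trans ?_
          refine (mul_le_of_le_one_right (norm_nonneg _)
            (ContinuousLinearMap.norm_inl_le_one ℝ E ℝ)).trans ?_
          exact (hC (x, t) ⟨hx, ht⟩).trans (le_abs_self C)
        · have h1 : HasFDerivAt J (fderiv ℝ J (x, t)) (x, t) :=
            ((hJs.contDiffAt (hO.mem_nhds (hsub ⟨hx, ht⟩))).differentiableAt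
              (by simp)).hasFDerivAt
          exact h1.comp (f := fun e => (e, t)) x (hasFDerivAt_prodMk_left x t)
      · refine ⟨0, by simp, (hasFDerivAt_const (0 : F) x).congr_of_eventuallyEq ?_⟩
        filter_upwards [(isClosed_tsupport χ).isOpen_compl.mem_nhds hx] with y hy
        rw [hzero y hy, zero_smul]
    refine ⟨‖C‖₊, ‖L‖₊, fun t ht => ⟨?_, fun x => ?_⟩⟩
    -- Extended by zero, the product has bounded derivative on the whole space, so `D` need not be
    -- convex.
    · refine lipschitzWith_of_nnnorm_fderiv_le (𝕜 := ℝ) (fun x => ?_) fun x => ?_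
      · obtain ⟨J', -, h⟩ := hder t ht x
        exact h.differentiableAt
      · obtain ⟨J', h1, h2⟩ := hder t ht x
        rw [h2.fderiv]
        exact h1
    · by_cases hx : x ∈ tsupport χ
      · exact (hL (x, t) ⟨hx, ht⟩).trans (le_abs_self L)
      · rw [hzero x hx, zero_smul, norm_zero]
        exact NNReal.coe_nonneg _

end ODE

namespace System

variable (S : System)

theorem contDiffOn_field :
    ContDiffOn ℝ ∞ (fun a : (ℝ × ℝ) × ℝ => S.field a.2 a.1) (S.D ×ˢ Ioi 0) := by
  have hO : IsOpen (S.D ×ˢ Ioi (0 : ℝ)) := S.isOpen_D.prod isOpen_Ioi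
  have hd : ∀ a ∈ S.D ×ˢ Ioi (0 : ℝ), ∀ w, fderiv ℝ (fun p => S.H p a.2) a.1 w
      = fderiv ℝ (fun a : (ℝ × ℝ) × ℝ => S.H a.1 a.2) a (w, 0) := fun a ha w => by
    have h1 := ((S.smooth_H.contDiffAt (hO.mem_nhds ha)).differentiableAt (by simp)).hasFDerivAt
    have h2 := h1.comp (f := fun e => (e, a.2)) a.1 (hasFDerivAt_prodMk_left a.1 a.2)
    have h3 : HasFDerivAt (fun p => S.H p a.2) _ a.1 := h2
    rw [h3.fderiv]
    simp
  have hs := S.smooth_H.fderiv_of_isOpen hO (m := ∞) (by simp)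
  have hdx : ContDiffOn ℝ ∞ (fun a : (ℝ × ℝ) × ℝ => dx (fun p => S.H p a.2) a.1)
      (S.D ×ˢ Ioi 0) :=
    (hs.clm_apply (contDiffOn_const (c := (((1, 0), 0) : (ℝ × ℝ) × ℝ)))).congr
      fun a ha => hd a ha (1, 0)
  have hdy : ContDiffOn ℝ ∞ (fun a : (ℝ × ℝ) × ℝ => dy (fun p => S.H p a.2) a.1)
      (S.D ×ˢ Ioi 0) :=
    (hs.clm_apply (contDiffOn_const (c := (((0, 1), 0) : (ℝ × ℝ) × ℝ)))).congr
      fun a ha => hd a ha (0, 1)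
  exact hdy.prodMk (hdx.neg.add S.smooth_F)

/-- Curves which solve the system as long as they are in a given compact set. -/
theorem exists_solution_in_compact {K : Set (ℝ × ℝ)} (hK : IsCompact K) (hKD : K ⊆ S.D) {τ : ℝ}
    (hτ : 0 < τ) (z₀ : ℝ × ℝ) :
    ∃ z : ℝ → ℝ × ℝ, z τ = z₀ ∧ ContinuousOn z (Ici τ) ∧
      ∀ t ≥ τ, z t ∈ K → HasDerivWithinAt z (S.field t (z t)) (Ici τ) t := by
  obtain ⟨χ, hχ, hχc, hχD, hχ1⟩ := exists_contDiff_cutoff hK S.isOpen_D hKD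
  obtain ⟨h1, h2⟩ := lipschitzWith_cutoff S.isOpen_D hχ hχc hχD S.contDiffOn_field hτ
  obtain ⟨z, hz0, hz⟩ := exists_global_solution (v := fun t x => χ x • S.field t x) h1 h2 z₀
  refine ⟨z, hz0, fun t ht => (hz t ht).continuousWithinAt, fun t ht hzt => ?_⟩
  have h := hz t ht
  rwa [hχ1 _ hzt, one_smul] at h

/-! ### The ω-limit set and the limiting flow. -/

theorem contDiffOn_limitField : ContDiffOn ℝ ∞ S.limitField S.D := S.contDiffOn_fieldCoeff 0

/-- Homogeneity: a small initial distance and a small field error, both η, give a proportionally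
small error over a fixed time. -/
theorem gronwallBound_self (K η x : ℝ) :
    gronwallBound η K η x = η * gronwallBound 1 K 1 x := by
  unfold gronwallBound
  split_ifs <;> ring

/-- The `ω`-limit set of a bounded solution is forward invariant under the limiting flow. -/
theorem mapClusterPt_flow {K : Set (ℝ × ℝ)} (hK : IsCompact K) (hKD : K ⊆ S.D) {τ : ℝ}
    {z : ℝ → ℝ × ℝ} (hzK : ∀ t ≥ τ, z t ∈ K)
    (hz : ∀ t ≥ τ, HasDerivWithinAt z (S.field t (z t)) (Ici τ) t) {u : ℝ → ℝ × ℝ}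
    (huK : ∀ t, u t ∈ K) (hu : ∀ t, HasDerivAt u (S.limitField (u t)) t) {a b : ℝ} (hab : a ≤ b)
    (ha : MapClusterPt (u a) atTop z) : MapClusterPt (u b) atTop z := by
  obtain ⟨χ, hχ, hχc, hχD, hχ1⟩ := exists_contDiff_cutoff hK S.isOpen_D hKD
  -- The limiting field is autonomous; the time interval [1, 1] is only a dummy.
  obtain ⟨k, _, hk⟩ := (lipschitzWith_cutoff S.isOpen_D hχ hχc hχD
    (G := fun a => S.limitField a.1) (S.contDiffOn_limitField.comp contDiffOn_fst
      fun _ h => h.1) one_pos).2 1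
  have hlip := (hk 1 ⟨le_rfl, le_rfl⟩).1
  obtain ⟨C, hC, T, hT, hfield⟩ := S.norm_field_sub_le hK hKD 0
  rw [mapClusterPt_iff_frequently] at ha ⊢
  intro s hs
  obtain ⟨ε, hε, hεs⟩ := Metric.mem_nhds_iff.1 hs
  set B := gronwallBound 1 k 1 (b - a) with hB
  set η := ε / (|B| + 1) with hη_def
  have hη : 0 < η := by positivity
  have hηB : gronwallBound η k η (b - a) < ε := by
    rw [gronwallBound_self, ← hB, hη_def, div_mul_eq_mul_div, div_lt_iff₀ (by positivity)]
    have := le_abs_self B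
    nlinarith
  have hsm : Tendsto (fun t => C * S.small t) atTop (𝓝 0) := by
    simpa using S.tendsto_small.const_mul C
  obtain ⟨T', hT'⟩ := eventually_atTop.1 (hsm.eventually (ge_mem_nhds hη))
  rw [frequently_atTop]
  intro N
  obtain ⟨t, ht, hzt⟩ := frequently_atTop.1 (ha _ (Metric.ball_mem_nhds (u a) hη))
    (max (max N τ) (max T T'))
  simp only [max_le_iff] at ht
  obtain ⟨⟨htN, htτ⟩, htT, htT'⟩ := ht
  refine ⟨t + (b - a), by linarith, hεs ?_⟩
  -- `z` on [t, t + b - a] is compared with `u` shifted so that u(a) corresponds to time t; `z`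
  -- solves the limiting equation up to O(t^{-1/q}) ≤ η.
  have hgw := dist_le_of_approx_trajectories_ODE (v := fun _ x => χ x • S.limitField x) (K := k)
    (f := z) (f' := fun r => S.field r (z r)) (g := fun r => u (r + (a - t)))
    (g' := fun r => S.limitField (u (r + (a - t)))) (a := t) (b := t + (b - a)) (δ := η)
    (εf := η) (εg := 0) (fun _ => hlip)
    (fun r hr => (hz r (htτ.trans hr.1)).continuousWithinAt.mono fun x hx => htτ.trans hx.1)
    (fun r hr => (hz r (htτ.trans hr.1)).mono (Ici_subset_Ici.2 (htτ.trans hr.1)))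
    (fun r hr => ?_) ?_ (fun r _ => ?_) (fun r _ => ?_) ?_ (t + (b - a)) ⟨by linarith, le_rfl⟩
  · rw [add_zero, add_sub_cancel_left, show t + (b - a) + (a - t) = b by ring] at hgw
    exact hgw.trans_lt hηB
  · have hzr := hzK r (htτ.trans hr.1)
    have h := hfield r (htT.trans hr.1) _ hzr
    simp only [zero_add, Finset.sum_range_one, pow_zero, one_smul, pow_one] at h
    rw [hχ1 _ hzr, one_smul, dist_eq_norm]
    exact h.trans (hT' r (htT'.trans hr.1))
  · exact fun r _ => ((hu _).comp_add_const r (a - t)).continuousAt.continuousWithinAt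
  · exact ((hu _).comp_add_const r (a - t)).hasDerivWithinAt
  · rw [hχ1 _ (huK _), one_smul, dist_self]
  · rw [show t + (a - t) = a by ring]
    exact (Metric.mem_ball.1 hzt).le

end System

namespace ActionAngle

variable {S : System} {E₀ : ℝ} (A : ActionAngle S E₀)

theorem hasDerivAt_chart_freq_mul {c : ℝ} (hc : c ∈ Ioo 0 E₀) (t : ℝ) :
    HasDerivAt (fun t => A.chart (c, A.freq c * t)) (S.limitField (A.chart (c, A.freq c * t))) t := by
  have h1 := (A.hasDerivAt_chart_snd hc (A.freq c * t)).scomp t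
    ((hasDerivAt_id t).const_mul (A.freq c))
  refine h1.congr_deriv ?_
  rw [mul_one]
  ext
  · exact A.eq_X c hc (A.freq c * t)
  · exact A.eq_Y c hc (A.freq c * t)

theorem range_chart_freq_mul {c : ℝ} (hc : c ∈ Ioo 0 E₀) :
    range (fun t => A.chart (c, A.freq c * t)) = S.levelCurve c := by
  rw [← A.range_eq c hc]
  have hω := (A.freq_pos c hc).ne'
  exact (mul_left_surjective₀ hω).range_comp fun φ => A.chart (c, φ)

theorem periodic_chart_freq_mul {c : ℝ} (hc : c ∈ Ioo 0 E₀) :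
    Function.Periodic (fun t => A.chart (c, A.freq c * t)) (2 * Real.pi / A.freq c) := fun t => by
  have h := A.periodic c hc (A.freq c * t)
  have hω := (A.freq_pos c hc).ne'
  simp only [mul_add, mul_div_cancel₀ _ hω]
  exact h

theorem isClosedOrbit_levelCurve (A : ActionAngle S E₀) {c : ℝ} (hc : c ∈ Ioo 0 E₀) :
    S.IsClosedOrbit (S.levelCurve c) := by
  have hω := A.freq_pos c hc
  refine ⟨2 * Real.pi / A.freq c, div_pos Real.two_pi_pos hω, _, A.hasDerivAt_chart_freq_mul hc,
    A.periodic_chart_freq_mul hc, fun t ht r hr htr => ?_, A.range_chart_freq_mul hc⟩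
  have hmem : ∀ t ∈ Ico 0 (2 * Real.pi / A.freq c), A.freq c * t ∈ Ico 0 (2 * Real.pi) :=
    fun t ht => ⟨mul_nonneg hω.le ht.1, by
      have := ht.2
      rw [lt_div_iff₀ hω] at this
      linarith⟩
  exact mul_left_cancel₀ hω.ne' (A.injOn c hc (hmem t ht) (hmem r hr) htr)

/-- Compare a point with the point of the level curve at the same angle; the chart is uniformly
continuous on a compact rectangle. -/
theorem exists_infDist_lt (A : ActionAngle S E₀) {c δ : ℝ} (hδ : 0 < δ) (hcδ : Icc (c - δ) (c + δ) ⊆ Ioo 0 E₀) {ε : ℝ}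
    (hε : 0 < ε) :
    ∃ η > 0, η ≤ δ ∧ ∀ p ∈ S.band c η, Metric.infDist p (S.levelCurve c) < ε := by
  have hu := (isCompact_Icc.prod isCompact_Icc).uniformContinuousOn_of_continuous
    (A.contDiffOn_chart.continuousOn.mono (prod_mono hcδ (subset_univ (Icc 0 (2 * Real.pi)))))
  obtain ⟨η, hη, h⟩ := Metric.uniformContinuousOn_iff.1 hu ε hε
  have hm : ∀ E, |E - c| ≤ δ → E ∈ Icc (c - δ) (c + δ) := fun E hE => by
    have := abs_le.1 hE
    constructor <;> linarith
  refine ⟨min (η / 2) δ, by positivity, min_le_right _ _, fun p hp => ?_⟩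
  have hpη : |S.H₀ p - c| ≤ η / 2 := hp.2.trans (min_le_left _ _)
  have hpδ : |S.H₀ p - c| ≤ δ := hp.2.trans (min_le_right _ _)
  obtain ⟨φ, hφ, hφp⟩ := A.exists_mem_Icc_chart_eq ⟨hp.1, hcδ (hm _ hpδ)⟩
  have hcm : c ∈ Icc (c - δ) (c + δ) := hm c (by simpa using hδ.le)
  have hd := h (S.H₀ p, φ) ⟨hm _ hpδ, hφ⟩ (c, φ) ⟨hcm, hφ⟩ (by
    rw [Prod.dist_eq, dist_self, Real.dist_eq, max_eq_left (abs_nonneg _)]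
    linarith)
  rw [hφp] at hd
  exact (Metric.infDist_le_dist_of_mem (A.chart_mem_levelCurve (hcδ hcm) φ)).trans_lt hd

theorem setOf_mapClusterPt_eq_levelCurve (A : ActionAngle S E₀) {c δ : ℝ} (hδ : 0 ≤ δ)
    (hcδ : Icc (c - δ) (c + δ) ⊆ Ioo 0 E₀)
    {τ : ℝ} {z : ℝ → ℝ × ℝ} (hzK : ∀ t ≥ τ, z t ∈ S.band c δ)
    (hz : ∀ t ≥ τ, HasDerivWithinAt z (S.field t (z t)) (Ici τ) t)
    (hlim : Tendsto (fun t => S.H₀ (z t)) atTop (𝓝 c)) :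
    {p | MapClusterPt p atTop z} = S.levelCurve c := by
  have hc : c ∈ Ioo 0 E₀ := hcδ ⟨by linarith, by linarith⟩
  have hK := A.isCompact_band hcδ
  have hKD : S.band c δ ⊆ S.D := fun p hp => hp.1
  have hev : ∀ᶠ t in atTop, z t ∈ S.band c δ := (eventually_ge_atTop τ).mono hzK
  have hsub : ∀ p, MapClusterPt p atTop z → p ∈ S.levelCurve c := fun p hp => by
    have hpK : p ∈ S.band c δ := hK.isClosed.mem_of_mapClusterPt hp hev
    refine ⟨hpK.1, ?_⟩
    have h1 : MapClusterPt (S.H₀ p) atTop (S.H₀ ∘ z) :=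
      hp.continuousAt_comp ((S.smooth_H₀.contDiffAt (S.isOpen_D.mem_nhds hpK.1)).continuousAt)
    have h2 : ClusterPt (S.H₀ p) (𝓝 c) := ClusterPt.mono h1 hlim
    exact eq_of_nhds_neBot h2
  refine Subset.antisymm hsub fun p hp => ?_
  obtain ⟨p₀, -, hp₀⟩ := hK.exists_mapClusterPt (le_principal_iff.2 hev)
  have hp₀γ := hsub p₀ hp₀
  have hω := A.freq_pos c hc
  have hrange := A.range_chart_freq_mul hc
  rw [← hrange] at hp hp₀γ
  obtain ⟨a, rfl⟩ := hp₀γ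
  obtain ⟨b, rfl⟩ := hp
  have hT : 0 < 2 * Real.pi / A.freq c := div_pos Real.two_pi_pos hω
  -- Only forward invariance is available, so the target time is moved by whole periods until it
  -- exceeds `a`.
  obtain ⟨m, hm⟩ := exists_nat_gt ((a - b) / (2 * Real.pi / A.freq c))
  rw [div_lt_iff₀ hT] at hm
  have hper := (A.periodic_chart_freq_mul hc).nat_mul m b
  change MapClusterPt (A.chart (c, A.freq c * b)) atTop z
  rw [← hper]
  refine S.mapClusterPt_flow hK hKD hzK hz (u := fun t => A.chart (c, A.freq c * t))
    (fun t => ?_) (A.hasDerivAt_chart_freq_mul hc) (by linarith) hp₀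
  have h := A.chart_mem_levelCurve hc (A.freq c * t)
  exact ⟨h.1, by rw [h.2]; simpa using hδ⟩

/-! ### Assembly of stability, convergence and the ω-limit set. -/

/-- Near a zero with negative derivative, a function is close to its linearization. -/
theorem exists_abs_add_le_of_deriv_neg {L : ℝ → ℝ} {c : ℝ} (h0 : L c = 0) (hneg : deriv L c < 0) :
    ∃ a > 0, ∃ δ > 0, ∀ E, |E - c| ≤ δ → |L E + 2 * a * (E - c)| ≤ a * |E - c| := by
  -- `deriv` is 0 where the derivative fails to exist, so a negative value already gives
  -- differentiability.
  have hd : HasDerivAt L (deriv L c) c := by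
    by_contra h
    have : ¬ DifferentiableAt ℝ L c := fun h' => h h'.hasDerivAt
    rw [deriv_zero_of_not_differentiableAt this] at hneg
    exact lt_irrefl _ hneg
  -- With a half of |L'(c)|, the linear part is -2a(E - c), and an error of a|E - c| leaves half the
  -- damping.
  have ha : 0 < -deriv L c / 2 := by linarith
  obtain ⟨δ, hδ, h⟩ := Metric.nhds_basis_closedBall.mem_iff.1 (hd.isLittleO.def ha)
  refine ⟨-deriv L c / 2, ha, δ, hδ, fun E hE => ?_⟩
  have h1 : ‖L E - L c - (E - c) • deriv L c‖ ≤ -deriv L c / 2 * ‖E - c‖ :=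
    h (show E ∈ Metric.closedBall c δ from hE)
  rw [h0, smul_eq_mul, Real.norm_eq_abs, Real.norm_eq_abs] at h1
  convert h1 using 2
  ring

theorem isStableLimitCycle {n : ℕ} (hn : 1 ≤ n) (hnq : n ≤ S.q)
    (hlow : ∀ k, 1 ≤ k → k < n → ∀ E ∈ Ioo 0 E₀, A.Lam k E = 0) {c : ℝ} (hc : c ∈ Ioo 0 E₀)
    (hzero : A.Lam n c = 0) (hneg : deriv (A.Lam n) c < 0) : S.IsStableLimitCycle c := by
  obtain ⟨a, ha, δ₁, hδ₁, hΛ₁⟩ := exists_abs_add_le_of_deriv_neg hzero hneg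
  obtain ⟨δ, hδ, hδδ₁, hcδ⟩ : ∃ δ > 0, δ ≤ δ₁ ∧ Icc (c - δ) (c + δ) ⊆ Ioo 0 E₀ := by
    obtain ⟨r, hr, h⟩ := Metric.nhds_basis_closedBall.mem_iff.1 (isOpen_Ioo.mem_nhds hc)
    refine ⟨min r δ₁, by positivity, min_le_right _ _, Subset.trans ?_ h⟩
    rw [Real.closedBall_eq_Icc]
    have := min_le_left r δ₁
    exact Icc_subset_Icc (by linarith) (by linarith)
  have hΛ : ∀ E, |E - c| ≤ δ → |A.Lam n E + 2 * a * (E - c)| ≤ a * |E - c| :=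
    fun E hE => hΛ₁ E (hE.trans hδδ₁)
  refine ⟨A.isClosedOrbit_levelCurve hc, fun ε hε => ?_⟩
  obtain ⟨η₁, hη₁, hη₁δ, hdist⟩ := A.exists_infDist_lt hδ hcδ hε
  set η := min η₁ ε
  have hη : 0 < η := lt_min hη₁ hε
  have hηδ : η ≤ δ := (min_le_left _ _).trans hη₁δ
  obtain ⟨T, hT, hconf⟩ := A.exists_confinement hn hnq hlow hδ ha hcδ hΛ hη hηδ
  refine ⟨η / 4, by positivity, T, by linarith, fun τ hτ z₀ hz₀ hz₀c => ⟨?_, ?_⟩⟩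
  -- The curve solves the system only while in the band; confinement shows that it never leaves, so
  -- it is a genuine solution.
  · obtain ⟨z, hz0, hzc, hz⟩ := S.exists_solution_in_compact (A.isCompact_band hcδ)
      (fun p hp => hp.1) (show 0 < τ by linarith) z₀
    have h := hconf τ hτ z hzc hz (by rwa [hz0]) (by rwa [hz0])
    exact ⟨z, fun t ht => ⟨(h t ht).1, hz t ht ⟨(h t ht).1, (h t ht).2.le.trans hηδ⟩⟩, hz0⟩
  · intro z hz hz0
    have h := hconf τ hτ z (fun t ht => (hz t ht).2.continuousWithinAt) (fun r hr _ => (hz r hr).2)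
      (by rwa [hz0]) (by rwa [hz0])
    have hband : ∀ t ≥ τ, z t ∈ S.band c δ := fun t ht =>
      ⟨(h t ht).1, (h t ht).2.le.trans hηδ⟩
    have hlim : Tendsto (fun t => S.H₀ (z t)) atTop (𝓝 c) :=
      (A.exists_energy_estimates hn hnq hlow hδ ha hcδ hΛ).2 τ (by linarith) z
        fun r hr => ⟨hband r hr, (hz r hr).2⟩
    refine ⟨fun t ht => ⟨(h t ht).2.trans_le (min_le_right _ _),
      hdist _ ⟨(h t ht).1, (h t ht).2.le.trans (min_le_left _ _)⟩⟩, hlim, ?_,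
      A.setOf_mapClusterPt_eq_levelCurve hδ.le hcδ hband (fun t ht => (hz t ht).2) hlim⟩
    rw [Metric.tendsto_atTop]
    intro ε' hε'
    obtain ⟨η', hη', -, hdist'⟩ := A.exists_infDist_lt hδ hcδ hε'
    obtain ⟨N, hN⟩ := Metric.tendsto_atTop.1 hlim η' hη'
    refine ⟨max N τ, fun t ht => ?_⟩
    have h1 := hN t ((le_max_left _ _).trans ht)
    rw [Real.dist_eq] at h1
    rw [Real.dist_eq, sub_zero, abs_of_nonneg Metric.infDist_nonneg]
    exact hdist' _ ⟨(h t ((le_max_right _ _).trans ht)).1, h1.le⟩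

end ActionAngle

end AsympHam

end

theorem mainTheorem10 (S : AsympHam.System) (E₀ : ℝ) (A : AsympHam.ActionAngle S E₀)
    (n : ℕ) (hn : 1 ≤ n) (hnq : n ≤ S.q)
    (hlow : ∀ k, 1 ≤ k → k < n → ∀ E ∈ Set.Ioo 0 E₀, A.Lam k E = 0)
    (s : ℕ) (V : Fin s → ℝ) (hV : ∀ l, V l ∈ Set.Ioo 0 E₀)
    (hzero : ∀ l, A.Lam n (V l) = 0) (hneg : ∀ l, deriv (A.Lam n) (V l) < 0) :
    ∀ l, S.IsStableLimitCycle (V l) := fun l =>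
  A.isStableLimitCycle hn hnq hlow (hV l) (hzero l) (hneg l)
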